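/- For real $x\ge 1$ let $M(x)=\sum_{n\le x}\mu(n)$, where $\mu$ is the Möbius function. Let $\rho=\beta+i\gamma$ run through the distinct non-trivial zeros of the Riemann zeta-function $\zeta$ (those with $0<\beta<1$), with $\gamma$ of either sign. The Linear Independence Conjecture is the assertion: if the Riemann Hypothesis holds, then the positive ordinates $\gamma$ of the distinct non-trivial zeros of $\zeta$ are linearly independent over $\mathbb{Q}$. Theorem. Assume the Linear Independence Conjecture and let $\kappa\le 3/2$ be real. Put $c_\kappa=\frac{2}{\zeta(1/2)}$ if $\kappa=3/2$ and $c_\kappa=0$ if $\kappa<3/2$. Then, in the extended real numbers, $$\limsup_{x\to\infty}\frac{1}{x^{3/2-\kappa}}\int_1^x\frac{M(u)}{u^{\kappa}}\,du\;\ge\; c_\kappa+\frac12\sum_{\gamma}\frac{1}{|\rho(\rho-\kappa+1)\zeta'(\rho)|},$$ $$\liminf_{x\to\infty}\frac{1}{x^{3/2-\kappa}}\int_1^x\frac{M(u)}{u^{\kappa}}\,du\;\le\; c_\kappa-\frac12\sum_{\gamma}\frac{1}{|\rho(\rho-\kappa+1)\zeta'(\rho)|},$$ where the sums are over all distinct non-trivial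 zeros $\rho$, the summand is understood to be $+\infty$ if $\rho$ is a multiple zero, and the sums may be $+\infty$. -/

import Mathlib

open scoped ENNReal

/-- The summatory function `M(x) = ∑_{n ≤ x} μ(n)` of the Möbius function. -/
noncomputable def mertens (x : ℝ) : ℝ :=
  ∑ n ∈ Finset.Icc 1 ⌊x⌋₊, (ArithmeticFunction.moebius n : ℝ)

/-- The set of (distinct) non-trivial zeros `ρ = β + iγ` of the Riemann zeta-function, that is, its
zeros in the critical strip `0 < β < 1`. -/
def nontrivialZeros : Set ℂ :=
  {ρ : ℂ | riemannZeta ρ = 0 ∧ 0 < ρ.re ∧ ρ.re < 1}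

/-- The Linear Independence Conjecture: if the Riemann Hypothesis holds, then the positive ordinates
of the distinct non-trivial zeros are linearly independent over `ℚ`. The family is indexed by
the zeros themselves. -/
def LinearIndependenceConjecture : Prop :=
  RiemannHypothesis →
    LinearIndependent ℚ (fun ρ : {ρ : ℂ // ρ ∈ nontrivialZeros ∧ 0 < ρ.im} => (ρ : ℂ).im)

/-- The sum `∑_γ 1 / |ρ (ρ - κ + 1) ζ'(ρ)|` over all non-trivial zeros (with `γ` of either sign), as
an element of `[0, ∞]`. In `ℝ≥0∞` one has `0⁻¹ = ∞`, so that a multiple zero, where `ζ'(ρ) = 0`,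
contributes `+∞`. -/
noncomputable def zeroSum (κ : ℝ) : ℝ≥0∞ :=
  ∑' ρ : nontrivialZeros, ‖(ρ : ℂ) * ((ρ : ℂ) - (κ : ℂ) + 1) * deriv riemannZeta (ρ : ℂ)‖ₑ⁻¹

/-- The term `2 / ζ(1/2)` (a real number), which is present only when `κ = 3/2`. -/
noncomputable def centralTerm (κ : ℝ) : ℝ :=
  open Classical in if κ = 3 / 2 then (2 / riemannZeta (1 / 2)).re else 0

/-- The normalized integral `x^{-(3/2 - κ)} ∫_1^x M(u) u^{-κ} du`. -/
noncomputable def normalizedIntegral (κ x : ℝ) : ℝ :=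
  (1 / x ^ (3 / 2 - κ)) * ∫ u in (1 : ℝ)..x, mertens u / u ^ κ

/-! Write N for the normalized integral, and suppose `ε * N ≤ C` eventually, with `ε = ±1`. Then `C
+ B / x - ε * N` is nonnegative on `(1, ∞)` for a suitable `B`, and its Mellin transform is `G(z) =
C / z + B / (z + 1) - ε (z - 1/2) / D(z)` with D = `mertensDenom κ`, whose zeros on the imaginary
axis are `z = ρ - 1/2`, together with `z = 0` if `κ = 3/2`. Positivity is used three times. By
Landau's lemma (`mem_integrableExpSet_of_analyticAt`), G converges for `Re z > 0`, because D has no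
positive real zero; hence RH holds and the independence conjecture can be applied. Next, `|G(σ +
it)| ≤ G(σ) = O(1/σ)` makes the zeros simple (`deriv_mertensDenom_ne_zero`). Last, the measure is
tested against Riesz products `∏ (1 + cos (γ_j X + θ_j))` as `σ → 0`: independence leaves only the
residues at 0 and `±iγ_j`, and the right phases give `∑ |R(γ_j)| ≤ R(0) = C - ε c_κ`
(`sum_norm_le_of_rieszProduct`, `sum_le_of_upperBound`). The sum over `γ > 0` is half the sum over
all zeros. Letting C approach the limsup (`ε = 1`), or -C the liminf (`ε = -1`), gives the theorem.
-/

/-! ### Landau's lemma for Laplace transforms of measures. -/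

open MeasureTheory ProbabilityTheory Filter Topology Complex in
/-- If the Taylor series of `complexMGF X μ` at a real point `a` is summable at `a - r`, where `X ≤ 0`,
then `exp ((a - r) X)` is integrable. -/
lemma mem_integrableExpSet_of_summable {Ω : Type*} {m : MeasurableSpace Ω} {μ : Measure Ω} {X : Ω → ℝ}
    (hX : AEMeasurable X μ) (hX0 : ∀ᵐ ω ∂μ, X ω ≤ 0) {a r : ℝ} (hr : 0 ≤ r)
    (ha : a ∈ interior (integrableExpSet X μ))
    (hs : Summable fun n : ℕ => r ^ n / n.factorial * ∫ ω, (-X ω) ^ n * Real.exp (a * X ω) ∂μ) :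
    a - r ∈ integrableExpSet X μ := by
  have hint : ∀ n : ℕ, Integrable (fun ω => (-X ω) ^ n * Real.exp (a * X ω)) μ := by
    intro n
    refine ((integrable_pow_mul_exp_of_mem_interior_integrableExpSet ha n).const_mul ((-1) ^ n)).congr
      (ae_of_all _ fun ω => ?_)
    simp only [neg_pow (X ω)]; ring
  have hnn : ∀ n : ℕ, 0 ≤ᵐ[μ] fun ω => r ^ n / n.factorial * ((-X ω) ^ n * Real.exp (a * X ω)) := by
    intro n
    filter_upwards [hX0] with ω hω
    have : 0 ≤ -X ω := by linarith
    simp only [Pi.zero_apply]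
    positivity
  refine ⟨by fun_prop, ?_⟩
  rw [hasFiniteIntegral_iff_ofReal (ae_of_all _ fun ω => (Real.exp_pos _).le)]
  -- As `X ≤ 0`, every term of the expansion of `exp (-r X)` is nonnegative, so Tonelli allows
  -- integration term by term.
  have key : ∀ᵐ ω ∂μ, ENNReal.ofReal (Real.exp ((a - r) * X ω)) =
      ∑' n : ℕ, ENNReal.ofReal (r ^ n / n.factorial * ((-X ω) ^ n * Real.exp (a * X ω))) := by
    filter_upwards [hX0] with ω hω
    have h0 : 0 ≤ -X ω := by linarith
    have h1 : HasSum (fun n : ℕ => r ^ n / n.factorial * ((-X ω) ^ n * Real.exp (a * X ω)))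
        (Real.exp ((a - r) * X ω)) := by
      have := (NormedSpace.expSeries_div_hasSum_exp (r * -X ω)).mul_right (Real.exp (a * X ω))
      rw [← Real.exp_eq_exp_ℝ, ← Real.exp_add] at this
      rw [show (a - r) * X ω = r * -X ω + a * X ω by ring]
      have e : (fun n : ℕ => r ^ n / n.factorial * ((-X ω) ^ n * Real.exp (a * X ω))) =
          fun n : ℕ => (r * -X ω) ^ n / n.factorial * Real.exp (a * X ω) := by
        ext n; rw [mul_pow]; ring
      rw [e]
      exact this
    rw [← ENNReal.ofReal_tsum_of_nonneg _ h1.summable, h1.tsum_eq]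
    intro n; positivity
  rw [lintegral_congr_ae key, lintegral_tsum]
  · have : ∀ n : ℕ, ∫⁻ ω, ENNReal.ofReal (r ^ n / n.factorial * ((-X ω) ^ n * Real.exp (a * X ω))) ∂μ
        = ENNReal.ofReal (r ^ n / n.factorial * ∫ ω, (-X ω) ^ n * Real.exp (a * X ω) ∂μ) := by
      intro n
      rw [← integral_const_mul, ofReal_integral_eq_lintegral_ofReal ((hint n).const_mul _) (hnn n)]
    simp_rw [this]
    exact hs.tsum_ofReal_lt_top
  · intro n; fun_prop

open MeasureTheory ProbabilityTheory Filter Topology Complex in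
/-- **Landau's lemma** for the Laplace transform of a measure: if the transform agrees far to the right
with a function analytic on the positive real axis, then it converges on the positive real axis. -/
lemma mem_integrableExpSet_of_analyticAt {Ω : Type*} {m : MeasurableSpace Ω} {μ : Measure Ω} {X : Ω → ℝ}
    (hX : AEMeasurable X μ) (hX0 : ∀ᵐ ω ∂μ, X ω ≤ 0) {b : ℝ} {H : ℂ → ℂ}
    (hb : ∀ t, b < t → t ∈ integrableExpSet X μ) (hH : ∀ t : ℝ, 0 < t → AnalyticAt ℂ H t)
    (heq : ∀ t : ℝ, b < t → complexMGF X μ t = H t) {t : ℝ} (ht : 0 < t) :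
    t ∈ integrableExpSet X μ := by
  set S : Set ℝ := {t | 0 < t ∧ t ∈ integrableExpSet X μ} with hS
  have hSne : S.Nonempty := ⟨max b 0 + 1, by positivity, hb _ (by linarith [le_max_left b 0])⟩
  have hSbdd : BddBelow S := ⟨0, fun x hx => hx.1.le⟩
  set s := sInf S with hs
  have hs0 : 0 ≤ s := le_csInf hSne fun x hx => hx.1.le
  have hup : ∀ u, s < u → u ∈ integrableExpSet X μ := by
    intro u hu
    obtain ⟨v, hv, hvu⟩ := exists_lt_of_csInf_lt hSne hu
    have hbig := hb (max b u + 1) (by linarith [le_max_left b u])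
    exact integrable_exp_mul_of_le_of_le hv.2 hbig hvu.le (by linarith [le_max_right b u])
  have hint : ∀ u, s < u → u ∈ interior (integrableExpSet X μ) := fun u hu =>
    interior_maximal (fun v hv => hup v hv) isOpen_Ioi hu
  by_contra hcon
  have hspos : 0 < s := lt_of_lt_of_le ht (not_lt.1 fun h => hcon (hup t h))
  have hofr : ∀ u : ℝ, AnalyticAt ℝ (fun v : ℝ => (v : ℂ)) u := fun u => ofRealCLM.analyticAt u
  have hEq : ∀ u : ℝ, s < u → complexMGF X μ u = H u := by
    have hA : AnalyticOnNhd ℝ (fun v : ℝ => complexMGF X μ v) (Set.Ioi s) := fun u hu => by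
      have : AnalyticAt ℂ (complexMGF X μ) (u : ℂ) := analyticAt_complexMGF (by simpa using hint u hu)
      exact (this.restrictScalars (𝕜 := ℝ)).comp_of_eq (hofr u) rfl
    have hB : AnalyticOnNhd ℝ (fun v : ℝ => H v) (Set.Ioi s) := fun u hu =>
      ((hH u (hspos.trans hu)).restrictScalars (𝕜 := ℝ)).comp_of_eq (hofr u) rfl
    have h := hA.eqOn_of_preconnected_of_eventuallyEq hB isPreconnected_Ioi
      (z₀ := max b s + 1) (by show s < _; linarith [le_max_right b s]) ?_
    · exact fun u hu => h hu
    · filter_upwards [lt_mem_nhds (show b < max b s + 1 by linarith [le_max_left b s])] with u hu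
      exact heq u hu
  obtain ⟨R, hR, hball⟩ := (hH s hspos).exists_ball_analyticOnNhd
  -- The disc of radius `3δ` about `a = s + δ` lies in the disc of radius `4δ ≤ R` about `s`, and
  -- contains `a - 2δ = s - δ`, which is left of the abscissa `s` and still positive.
  set δ := min (R / 4) (s / 2) with hδ
  have hδpos : 0 < δ := by positivity
  have hδR : 4 * δ ≤ R := by linarith [min_le_left (R / 4) (s / 2)]
  have hδs : δ < s := by linarith [min_le_right (R / 4) (s / 2)]
  set a := s + δ with ha
  have haint := hint a (by linarith)
  -- Agreement on the real axis extends to a complex neighbourhood, so the Taylor coefficients of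
  -- `H` at `a` are moments.
  have hEqa : complexMGF X μ =ᶠ[𝓝 (a : ℂ)] H := by
    have h1 : AnalyticAt ℂ (complexMGF X μ) (a : ℂ) := analyticAt_complexMGF (by simpa using haint)
    refine (h1.frequently_eq_iff_eventually_eq (hH a (by linarith))).1 ?_
    have h2 : ∃ᶠ u : ℝ in 𝓝[≠] a, complexMGF X μ u = H u := by
      refine Eventually.frequently ?_
      filter_upwards [nhdsWithin_le_nhds (lt_mem_nhds (show s < a by linarith))] with u hu
      exact hEq u hu
    refine Tendsto.frequently ?_ h2
    refine tendsto_nhdsWithin_iff.2 ⟨(continuous_ofReal.tendsto a).mono_left nhdsWithin_le_nhds, ?_⟩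
    filter_upwards [self_mem_nhdsWithin] with u hu
    simpa using hu
  have hder : ∀ n : ℕ, iteratedDeriv n H a = ∫ ω, (X ω : ℂ) ^ n * cexp (a * X ω) ∂μ := by
    intro n
    rw [← hEqa.iteratedDeriv_eq, iteratedDeriv_complexMGF (by simpa using haint)]
  have hdiff : DifferentiableOn ℂ H (Metric.ball (a : ℂ) (3 * δ)) := by
    refine hball.differentiableOn.mono (Metric.ball_subset_ball' ?_)
    rw [dist_eq, ha, ofReal_add, add_sub_cancel_left, norm_real, Real.norm_eq_abs, abs_of_pos hδpos]
    linarith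
  have hsum := Complex.hasSum_taylorSeries_on_ball (r := 3 * δ) hdiff
    (z := ((a - 2 * δ : ℝ) : ℂ)) (by
      rw [Metric.mem_ball, dist_eq, ← ofReal_sub, norm_real, Real.norm_eq_abs]
      rw [show a - 2 * δ - a = -(2 * δ) by ring, abs_neg, abs_of_pos (by positivity)]
      linarith)
  have hsum2 : Summable fun n : ℕ =>
      (2 * δ) ^ n / n.factorial * ∫ ω, (-X ω) ^ n * Real.exp (a * X ω) ∂μ := by
    rw [← Complex.summable_ofReal]
    refine hsum.summable.congr fun n => ?_
    rw [hder]
    have : ∫ ω, (X ω : ℂ) ^ n * cexp (a * X ω) ∂μ =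
        (((-1) ^ n * ∫ ω, (-X ω) ^ n * Real.exp (a * X ω) ∂μ : ℝ) : ℂ) := by
      rw [← integral_const_mul, ← integral_complex_ofReal]
      refine integral_congr_ae (ae_of_all _ fun ω => ?_)
      push_cast
      rw [neg_pow (X ω : ℂ), ← mul_assoc, ← mul_assoc, ← mul_pow]
      simp
    rw [this]
    generalize ∫ ω, (-X ω) ^ n * Real.exp (a * X ω) ∂μ = J
    rw [← ofReal_sub, show a - 2 * δ - a = -(2 * δ) by ring]
    simp only [smul_eq_mul]
    push_cast
    rw [neg_pow (2 * (δ : ℂ)), ← mul_assoc]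
    have h3 : ((-1 : ℂ) ^ n) * (-1) ^ n = 1 := by rw [← mul_pow]; simp
    linear_combination ((n.factorial : ℂ)⁻¹ * (2 * (δ : ℂ)) ^ n * J) * h3
  have := mem_integrableExpSet_of_summable hX hX0 (by positivity) haint hsum2
  have hmem : a - 2 * δ ∈ S := ⟨by simp only [ha]; linarith, this⟩
  have := csInf_le hSbdd hmem
  linarith

-- Landau's lemma for `P / Q`, followed by the identity theorem in the half-plane. The product form
-- remains meaningful at complex zeros of `Q`, and forces `P` to vanish there.
open MeasureTheory ProbabilityTheory Filter Topology Complex in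
lemma complexMGF_continuation {Ω : Type*} {m : MeasurableSpace Ω} {μ : Measure Ω} {X : Ω → ℝ}
    (hX : AEMeasurable X μ) (hX0 : ∀ᵐ ω ∂μ, X ω ≤ 0) {b : ℝ} {P Q : ℂ → ℂ}
    (hP : Differentiable ℂ P) (hQ : Differentiable ℂ Q) (hQ0 : ∀ t : ℝ, 0 < t → Q t ≠ 0)
    (hb : ∀ t, b < t → t ∈ integrableExpSet X μ)
    (heq : ∀ z : ℂ, b < z.re → Q z * complexMGF X μ z = P z) :
    (∀ t, 0 < t → t ∈ integrableExpSet X μ) ∧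
      ∀ z : ℂ, 0 < z.re → Q z * complexMGF X μ z = P z := by
  have h1 : ∀ t, 0 < t → t ∈ integrableExpSet X μ := by
    intro t ht
    refine mem_integrableExpSet_of_analyticAt hX hX0 (b := max b 0) (H := fun z => P z / Q z)
      (fun t ht => hb t (lt_of_le_of_lt (le_max_left _ _) ht))
      (fun t ht => (hP.analyticAt _).div (hQ.analyticAt _) (hQ0 t ht)) (fun t ht => ?_) ht
    rw [eq_div_iff (hQ0 t (lt_of_le_of_lt (le_max_right _ _) ht)), mul_comm]
    exact heq t (by simpa using lt_of_le_of_lt (le_max_left _ _) ht)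
  refine ⟨h1, ?_⟩
  have hint : ∀ t, 0 < t → t ∈ interior (integrableExpSet X μ) := fun u hu =>
    interior_maximal (fun v hv => h1 v hv) isOpen_Ioi hu
  have hA : AnalyticOnNhd ℂ (fun z => Q z * complexMGF X μ z) {z | 0 < z.re} := fun z hz =>
    (hQ.analyticAt z).mul (analyticAt_complexMGF (hint _ hz))
  have hB : AnalyticOnNhd ℂ P {z | 0 < z.re} := fun z hz => hP.analyticAt z
  have hpre : IsPreconnected {z : ℂ | 0 < z.re} := (convex_halfSpace_re_gt 0).isPreconnected
  have h := hA.eqOn_of_preconnected_of_eventuallyEq hB hpre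
      (z₀ := ((max b 0 + 1 : ℝ) : ℂ)) (by
        rw [Set.mem_ofPred_eq, ofReal_re]; positivity) ?_
  · exact fun z hz => h hz
  · have : {z : ℂ | b < z.re} ∈ 𝓝 ((max b 0 + 1 : ℝ) : ℂ) :=
      (isOpen_lt continuous_const continuous_re).mem_nhds (by
        rw [Set.mem_ofPred_eq, ofReal_re]; linarith [le_max_left b 0])
    filter_upwards [this] with z hz
    exact heq z hz

/-! ### Residues on the imaginary axis as horizontal limits. -/

open Filter Topology Complex in
lemma tendsto_ofReal_add_mul_I (t : ℝ) :
    Tendsto (fun σ : ℝ => (σ : ℂ) + t * I) (𝓝[>] 0) (𝓝 (t * I)) := by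
  have : Continuous fun σ : ℝ => (σ : ℂ) + t * I := by fun_prop
  simpa using (this.tendsto 0).mono_left nhdsWithin_le_nhds

open Filter Topology Complex in
lemma tendsto_ofReal_nhdsGT_zero : Tendsto (fun σ : ℝ => (σ : ℂ)) (𝓝[>] 0) (𝓝 0) := by
  simpa using (continuous_ofReal.tendsto 0).mono_left nhdsWithin_le_nhds

open Filter Topology Complex in
lemma tendsto_div_ofReal {D : ℂ → ℂ} (hD : Differentiable ℂ D) {t : ℝ} (h0 : D (t * I) = 0) :
    Tendsto (fun σ : ℝ => D (σ + t * I) / σ) (𝓝[>] 0) (𝓝 (deriv D (t * I))) := by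
  have h1 : HasDerivAt (fun z : ℂ => D (z + t * I)) (deriv D (t * I)) ((0 : ℝ) : ℂ) := by
    refine HasDerivAt.comp_add_const _ _ ?_
    simpa using (hD (t * I)).hasDerivAt
  have h2 := h1.comp_ofReal.tendsto_slope_zero
  refine (h2.mono_left (nhdsWithin_mono 0 fun x (hx : 0 < x) => hx.ne')).congr fun σ => ?_
  simp [h0, div_eq_inv_mul]

open Filter Topology Complex in
lemma tendsto_mul_div_of_ne_zero {D E : ℂ → ℂ} (hD : Continuous D) (hE : Continuous E) {t : ℝ}
    (h0 : D (t * I) ≠ 0) :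
    Tendsto (fun σ : ℝ => σ * (E (σ + t * I) / D (σ + t * I))) (𝓝[>] 0) (𝓝 0) := by
  have h1 := tendsto_ofReal_add_mul_I t
  simpa using tendsto_ofReal_nhdsGT_zero.mul
    (((hE.tendsto _).comp h1).div ((hD.tendsto _).comp h1) h0)

open Filter Topology Complex in
lemma tendsto_mul_div_of_deriv_ne_zero {D E : ℂ → ℂ} (hD : Differentiable ℂ D) (hE : Continuous E)
    {t : ℝ} (h0 : D (t * I) = 0) (h1 : deriv D (t * I) ≠ 0) :
    Tendsto (fun σ : ℝ => σ * (E (σ + t * I) / D (σ + t * I))) (𝓝[>] 0)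
      (𝓝 (E (t * I) / deriv D (t * I))) := by
  refine (((hE.tendsto _).comp (tendsto_ofReal_add_mul_I t)).div (tendsto_div_ofReal hD h0) h1).congr
    fun σ => ?_
  change E (σ + t * I) / (D (σ + t * I) / σ) = _
  rw [div_div_eq_mul_div]; ring

-- A multiple zero of `D` would give `E / D` a pole of order at least two, against the bound
-- `O(1/σ)`, unless `E` vanishes too.
open Filter Topology Complex in
lemma eq_zero_of_deriv_eq_zero {D E : ℂ → ℂ} (hD : Differentiable ℂ D) (hE : Continuous E)
    {t K : ℝ} (h0 : D (t * I) = 0) (h1 : deriv D (t * I) = 0)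
    (hne : ∀ σ : ℝ, 0 < σ → D (σ + t * I) ≠ 0)
    (hK : ∀ᶠ σ : ℝ in 𝓝[>] 0, ‖(σ : ℂ) * (E (σ + t * I) / D (σ + t * I))‖ ≤ K) :
    E (t * I) = 0 := by
  have h2 : Tendsto (fun σ : ℝ => E (σ + t * I)) (𝓝[>] 0) (𝓝 (E (t * I))) :=
    (hE.tendsto _).comp (tendsto_ofReal_add_mul_I t)
  refine tendsto_nhds_unique h2 ?_
  have h3 := tendsto_div_ofReal hD h0
  rw [h1] at h3
  have h5 := h3.norm.const_mul K
  rw [norm_zero, mul_zero] at h5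
  refine squeeze_zero_norm' ?_ h5
  filter_upwards [hK, self_mem_nhdsWithin] with σ hσ (hpos : 0 < σ)
  have h4 : E (σ + t * I) = ((σ : ℂ) * (E (σ + t * I) / D (σ + t * I))) * (D (σ + t * I) / σ) := by
    have := hne σ hpos
    have : (σ : ℂ) ≠ 0 := by exact_mod_cast hpos.ne'
    field_simp
  rw [h4, norm_mul]
  exact mul_le_mul_of_nonneg_right hσ (norm_nonneg (D (σ + t * I) / σ))

/-! ### Riesz products. -/

open MeasureTheory ProbabilityTheory Filter Topology Complex ComplexConjugate in
lemma complexMGF_conj {Ω : Type*} {m : MeasurableSpace Ω} (X : Ω → ℝ) (μ : Measure Ω) (z : ℂ) :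
    complexMGF X μ (conj z) = conj (complexMGF X μ z) := by
  simp only [complexMGF]
  rw [← integral_conj]
  refine integral_congr_ae (ae_of_all _ fun ω => ?_)
  simp [← exp_conj]

/-- The Fourier coefficient at `k ∈ {-1, 0, 1}` of `1 + cos (y + θ)`. -/
noncomputable def cosineCoeff (θ : ℝ) (k : ℤ) : ℂ :=
  if k = 0 then 1 else Complex.exp (k * θ * Complex.I) / 2

open Complex in
lemma sum_cosineCoeff (θ y : ℝ) :
    ∑ k ∈ ({-1, 0, 1} : Finset ℤ), cosineCoeff θ k * cexp (k * y * I) =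
      ((1 + Real.cos (y + θ) : ℝ) : ℂ) := by
  have hz (u v : ℂ) : cexp u / 2 * cexp v = cexp (v + u) / 2 := by rw [Complex.exp_add]; ring
  simp only [cosineCoeff, Int.reduceNeg]
  rw [Finset.sum_insert (by simp), Finset.sum_insert (by simp), Finset.sum_singleton]
  simp only [Int.reduceNeg, neg_eq_zero, one_ne_zero, if_false, if_true, hz]
  push_cast
  rw [Complex.cos]
  ring_nf
  simp
  ring

open MeasureTheory ProbabilityTheory Filter Topology Complex in
/-- Testing a measure against the Riesz product `∏ (1 + cos (γ_j X + θ_j))`. -/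
lemma re_sum_rieszProduct_nonneg {Ω : Type*} {m : MeasurableSpace Ω} {μ : Measure Ω} {X : Ω → ℝ}
    (hX : AEMeasurable X μ) (hint : ∀ t, 0 < t → t ∈ integrableExpSet X μ) {R : ℝ → ℂ}
    (hR : ∀ t : ℝ, Tendsto (fun σ : ℝ => σ * complexMGF X μ (σ + t * I)) (𝓝[>] 0) (𝓝 (R t)))
    {ι : Type*} [Fintype ι] [DecidableEq ι] (γ θ : ι → ℝ) :
    0 ≤ (∑ p ∈ Fintype.piFinset (fun _ : ι => ({-1, 0, 1} : Finset ℤ)),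
      (∏ j, cosineCoeff (θ j) (p j)) * R (∑ j, p j * γ j)).re := by
  set F := Fintype.piFinset (fun _ : ι => ({-1, 0, 1} : Finset ℤ))
  have hlim : Tendsto (fun σ : ℝ => (∑ p ∈ F, (∏ j, cosineCoeff (θ j) (p j)) *
      (σ * complexMGF X μ (σ + (∑ j, p j * γ j : ℝ) * I))).re) (𝓝[>] 0)
      (𝓝 (∑ p ∈ F, (∏ j, cosineCoeff (θ j) (p j)) * R (∑ j, p j * γ j)).re) :=
    (continuous_re.tendsto _).comp (tendsto_finsetSum _ fun p _ => (hR _).const_mul _)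
  refine ge_of_tendsto hlim ?_
  filter_upwards [self_mem_nhdsWithin] with σ (hσ : 0 < σ)
  have hI : ∀ t : ℝ, Integrable (fun ω => cexp ((σ + t * I) * X ω)) μ := fun t =>
    integrable_cexp_mul_of_re_mem_integrableExpSet hX (by simpa using hint σ hσ)
  -- Before the limit, the sum is the integral of the nonnegative Riesz product against `σ exp (σ X)
  -- dμ`.
  have key : ∑ p ∈ F, (∏ j, cosineCoeff (θ j) (p j)) *
      (σ * complexMGF X μ (σ + (∑ j, p j * γ j : ℝ) * I)) =
      ((σ * ∫ ω, Real.exp (σ * X ω) * ∏ j, (1 + Real.cos (γ j * X ω + θ j)) ∂μ : ℝ) : ℂ) := by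
    push_cast
    rw [← integral_complex_ofReal]
    simp only [complexMGF]
    have : ∀ ω, ((Real.exp (σ * X ω) * ∏ j, (1 + Real.cos (γ j * X ω + θ j)) : ℝ) : ℂ) =
        ∑ p ∈ F, (∏ j, cosineCoeff (θ j) (p j)) *
          cexp ((σ + (∑ j, p j * γ j : ℝ) * I) * X ω) := by
      intro ω
      rw [ofReal_mul, ofReal_prod]
      simp_rw [← sum_cosineCoeff]
      rw [Finset.prod_univ_sum, Finset.mul_sum]
      refine Finset.sum_congr rfl fun p _ => ?_
      rw [Finset.prod_mul_distrib, ← Complex.exp_sum, mul_left_comm, ofReal_exp, ← Complex.exp_add]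
      congr 2
      push_cast
      rw [add_mul, Finset.sum_mul, Finset.sum_mul]
      congr 1
      refine Finset.sum_congr rfl fun j _ => ?_
      ring
    simp_rw [this]
    rw [integral_finsetSum _ fun p _ => (hI _).const_mul _, Finset.mul_sum]
    refine Finset.sum_congr rfl fun p _ => ?_
    rw [integral_const_mul]
    push_cast
    ring
  rw [key, ofReal_re]
  refine mul_nonneg hσ.le (integral_nonneg fun ω => mul_nonneg (Real.exp_pos _).le
    (Finset.prod_nonneg fun j _ => ?_))
  linarith [Real.neg_one_le_cos (γ j * X ω + θ j)]

open Complex in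
lemma sum_cosineCoeff_piFinset {ι : Type*} [Fintype ι] [DecidableEq ι] (γ θ : ι → ℝ) {R : ℝ → ℂ}
    (hR : ∀ p : ι → ℤ, (∀ j, p j ∈ ({-1, 0, 1} : Finset ℤ)) → p ≠ 0 →
      (∀ j, p ≠ Pi.single j 1 ∧ p ≠ Pi.single j (-1)) → R (∑ j, p j * γ j) = 0) :
    ∑ p ∈ Fintype.piFinset (fun _ : ι => ({-1, 0, 1} : Finset ℤ)),
      (∏ j, cosineCoeff (θ j) (p j)) * R (∑ j, p j * γ j) =
    R 0 + ∑ j, (cexp (θ j * I) / 2 * R (γ j) + cexp (-(θ j * I)) / 2 * R (-γ j)) := by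
  set T : (ι → ℤ) → ℂ := fun p => (∏ j, cosineCoeff (θ j) (p j)) * R (∑ j, p j * γ j) with hT
  have hprod : ∀ (i : ι) (k : ℤ), ∏ j, cosineCoeff (θ j) ((Pi.single i k : ι → ℤ) j) =
      cosineCoeff (θ i) k := by
    intro i k
    rw [Finset.prod_eq_single i]
    · simp
    · intro j _ hj; simp [hj, cosineCoeff]
    · simp
  have hsum : ∀ (i : ι) (k : ℤ), ∑ j, ((Pi.single i k : ι → ℤ) j : ℝ) * γ j = k * γ i := by
    intro i k
    rw [Finset.sum_eq_single i]
    · simp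
    · intro j _ hj; simp [hj]
    · simp
  have hT0 : T 0 = R 0 := by simp [hT, cosineCoeff]
  have hT1 : ∀ i, T (Pi.single i 1) = cexp (θ i * I) / 2 * R (γ i) := by
    intro i; simp only [hT]; rw [hprod, hsum]; simp [cosineCoeff]
  have hT2 : ∀ i, T (Pi.single i (-1)) = cexp (-(θ i * I)) / 2 * R (-γ i) := by
    intro i; simp only [hT]; rw [hprod, hsum]; simp [cosineCoeff]
  have hinj : ∀ k : ℤ, k ≠ 0 → Function.Injective fun i : ι => (Pi.single i k : ι → ℤ) := by
    intro k hk i j hij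
    by_contra hne
    have := congr_fun hij i
    simp [hne, hk] at this
  set A := Finset.univ.image fun i : ι => (Pi.single i 1 : ι → ℤ) with hA
  set B := Finset.univ.image fun i : ι => (Pi.single i (-1) : ι → ℤ) with hB
  have hdis : Disjoint A B := by
    rw [Finset.disjoint_left]
    intro p hp hp'
    simp only [hA, hB, Finset.mem_image, Finset.mem_univ, true_and] at hp hp'
    obtain ⟨i, rfl⟩ := hp
    obtain ⟨j, hj⟩ := hp'
    have := congr_fun hj i
    by_cases hij : i = j
    · subst hij; simp at this
    · simp [hij] at this
  have h0 : (0 : ι → ℤ) ∉ A ∪ B := by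
    simp only [hA, hB, Finset.mem_union, Finset.mem_image, Finset.mem_univ, true_and]
    rintro (⟨i, hi⟩ | ⟨i, hi⟩) <;> simpa using congr_fun hi i
  have hsub : insert 0 (A ∪ B) ⊆ Fintype.piFinset (fun _ : ι => ({-1, 0, 1} : Finset ℤ)) := by
    intro p hp
    simp only [hA, hB, Finset.mem_insert, Finset.mem_union, Finset.mem_image, Finset.mem_univ,
      true_and] at hp
    rw [Fintype.mem_piFinset]
    rcases hp with rfl | ⟨i, rfl⟩ | ⟨i, rfl⟩ <;> intro j
    · simp
    · by_cases hij : j = i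
      · subst hij; simp
      · simp [hij]
    · by_cases hij : j = i
      · subst hij; simp
      · simp [hij]
  rw [← Finset.sum_subset hsub, Finset.sum_insert h0, Finset.sum_union hdis,
    Finset.sum_image ((hinj 1 one_ne_zero).injOn), Finset.sum_image ((hinj (-1) (by simp)).injOn),
    Finset.sum_add_distrib]
  · change T 0 + (∑ i, T (Pi.single i 1) + ∑ i, T (Pi.single i (-1))) = _
    simp_rw [hT0, hT1, hT2]
  · intro p hp hp'
    simp only [hA, hB, Finset.mem_insert, Finset.mem_union, Finset.mem_image, Finset.mem_univ,
      true_and, not_or, not_exists] at hp'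
    rw [hR p (Fintype.mem_piFinset.1 hp) hp'.1
      fun j => ⟨fun h => hp'.2.1 j h.symm, fun h => hp'.2.2 j h.symm⟩, mul_zero]

-- The phases `θ j = π - arg R(γ j)` turn the contribution of each pair `±γ j` into `-‖R (γ j)‖`.
open MeasureTheory ProbabilityTheory Filter Topology Complex ComplexConjugate in
lemma sum_norm_le_of_rieszProduct {Ω : Type*} {m : MeasurableSpace Ω} {μ : Measure Ω} {X : Ω → ℝ}
    (hX : AEMeasurable X μ) (hint : ∀ t, 0 < t → t ∈ integrableExpSet X μ) {R : ℝ → ℂ}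
    (hR : ∀ t : ℝ, Tendsto (fun σ : ℝ => σ * complexMGF X μ (σ + t * I)) (𝓝[>] 0) (𝓝 (R t)))
    {ι : Type*} [Fintype ι] [DecidableEq ι] (γ : ι → ℝ)
    (hγ : ∀ p : ι → ℤ, (∀ j, p j ∈ ({-1, 0, 1} : Finset ℤ)) → p ≠ 0 →
      (∀ j, p ≠ Pi.single j 1 ∧ p ≠ Pi.single j (-1)) → R (∑ j, p j * γ j) = 0) :
    ∑ j, ‖R (γ j)‖ ≤ (R 0).re := by
  have hconj : ∀ t, R (-t) = conj (R t) := by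
    intro t
    refine tendsto_nhds_unique (hR (-t)) (((continuous_conj.tendsto _).comp (hR t)).congr fun σ => ?_)
    simp only [Function.comp, map_mul, conj_ofReal, ← complexMGF_conj]
    simp
  set θ : ι → ℝ := fun j => Real.pi - arg (R (γ j)) with hθ
  have h := re_sum_rieszProduct_nonneg hX hint hR γ θ
  rw [sum_cosineCoeff_piFinset γ θ hγ, add_re, re_sum] at h
  have h1 : ∀ j, (cexp (θ j * I) / 2 * R (γ j) + cexp (-(θ j * I)) / 2 * R (-γ j)).re =
      -‖R (γ j)‖ := by
    intro j
    have h2 : cexp (θ j * I) * R (γ j) = -‖R (γ j)‖ := by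
      conv_lhs => rw [← norm_mul_exp_arg_mul_I (R (γ j))]
      rw [mul_left_comm, ← Complex.exp_add, hθ]
      have : ((Real.pi - arg (R (γ j)) : ℝ) : ℂ) * I + arg (R (γ j)) * I = Real.pi * I := by
        push_cast; ring
      rw [this, exp_pi_mul_I]; ring
    have h3 : cexp (-(θ j * I)) = conj (cexp (θ j * I)) := by simp [← exp_conj]
    rw [hconj, h3, div_mul_eq_mul_div, div_mul_eq_mul_div, ← map_mul, h2]
    simp
  simp_rw [h1] at h
  rw [Finset.sum_neg_distrib] at h
  linarith

/-! ### Mellin transforms as moment generating functions. -/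

open MeasureTheory in
/-- The measure `g(x) dx / x` on `(1, ∞)`; its moment generating function with respect to `-log` is the
Mellin-type transform `z ↦ ∫_1^∞ g(x) x^{-z-1} dx`. -/
noncomputable def mellinMeasure (g : ℝ → ℝ) : Measure ℝ :=
  (volume.restrict (Set.Ioi 1)).withDensity fun x => ENNReal.ofReal (g x / x)

section mellinMeasure

open MeasureTheory ProbabilityTheory

variable {g : ℝ → ℝ}

lemma aemeasurable_neg_log_mellinMeasure : AEMeasurable (fun x => -Real.log x) (mellinMeasure g) := by
  fun_prop

lemma neg_log_nonpos_ae_mellinMeasure : ∀ᵐ x ∂mellinMeasure g, -Real.log x ≤ 0 := by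
  refine (withDensity_absolutelyContinuous _ _).ae_le ?_
  filter_upwards [ae_restrict_mem measurableSet_Ioi] with x (hx : 1 < x)
  linarith [Real.log_nonneg hx.le]

lemma complexMGF_mellinMeasure (hg : AEMeasurable g (volume.restrict (Set.Ioi 1)))
    (hg0 : ∀ x, 1 < x → 0 ≤ g x) (z : ℂ) :
    complexMGF (fun x => -Real.log x) (mellinMeasure g) z =
      ∫ x in Set.Ioi (1 : ℝ), (g x : ℂ) * (x : ℂ) ^ (-z - 1) := by
  rw [complexMGF, mellinMeasure, integral_withDensity_eq_integral_toReal_smul₀ (by fun_prop) (by simp)]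
  refine setIntegral_congr_fun measurableSet_Ioi fun x (hx : 1 < x) => ?_
  have hx0 : 0 < x := by linarith
  have hx1 : (x : ℂ) ≠ 0 := by exact_mod_cast hx0.ne'
  rw [ENNReal.toReal_ofReal (div_nonneg (hg0 x hx) hx0.le), Complex.cpow_sub _ _ hx1, Complex.cpow_one,
    Complex.cpow_def_of_ne_zero hx1, Complex.real_smul, ← Complex.ofReal_log hx0.le]
  push_cast
  rw [mul_neg, mul_neg, mul_comm z]
  ring

lemma mem_integrableExpSet_mellinMeasure (hg : AEMeasurable g (volume.restrict (Set.Ioi 1)))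
    (hg0 : ∀ x, 1 < x → 0 ≤ g x) {t : ℝ} :
    t ∈ integrableExpSet (fun x => -Real.log x) (mellinMeasure g) ↔
      IntegrableOn (fun x => g x * x ^ (-t - 1)) (Set.Ioi 1) := by
  rw [integrableExpSet, Set.mem_ofPred_eq, mellinMeasure,
    integrable_withDensity_iff_integrable_smul₀' (by fun_prop) (by simp)]
  refine integrableOn_congr_fun (fun x (hx : 1 < x) => ?_) measurableSet_Ioi
  have hx0 : 0 < x := by linarith
  rw [ENNReal.toReal_ofReal (div_nonneg (hg0 x hx) hx0.le), Real.rpow_sub hx0, Real.rpow_one,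
    Real.rpow_def_of_pos hx0, smul_eq_mul, mul_neg, mul_neg, mul_comm t]
  ring

end mellinMeasure

/-! ### The zeta-function in `Re s > 0`, its real zeros, and a criterion for RH. -/

open MeasureTheory ProbabilityTheory in
lemma mem_integrableExpSet_fract {t : ℝ} (ht : 0 < t) :
    t ∈ integrableExpSet (fun x => -Real.log x) (mellinMeasure Int.fract) := by
  rw [mem_integrableExpSet_mellinMeasure measurable_fract.aemeasurable fun x _ => Int.fract_nonneg x]
  have h := integrableOn_Ioi_rpow_of_lt (show -t - 1 < -1 by linarith) one_pos
  refine Integrable.mono h ?_ ?_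
  · exact (measurable_fract.aestronglyMeasurable).mul h.aestronglyMeasurable
  · refine Filter.Eventually.of_forall fun x => ?_
    rw [norm_mul, Real.norm_of_nonneg (Int.fract_nonneg x)]
    exact mul_le_of_le_one_left (norm_nonneg _) (Int.fract_lt_one x).le

-- Partial summation, with `⌊x⌋ = x - {x}`.
open MeasureTheory ProbabilityTheory in
lemma riemannZeta_eq_of_one_lt_re {s : ℂ} (hs : 1 < s.re) :
    riemannZeta s = s / (s - 1) -
      s * complexMGF (fun x => -Real.log x) (mellinMeasure Int.fract) s := by
  have hs0 : 0 < s.re := by linarith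
  rw [complexMGF_mellinMeasure measurable_fract.aemeasurable fun x _ => Int.fract_nonneg x]
  have hL := LSeries_eq_mul_integral (1 : ℕ → ℂ) zero_le_one hs
    (by simpa using LSeriesSummable_one_iff.2 hs) (by
      refine Asymptotics.IsBigO.of_bound 1 (Filter.Eventually.of_forall fun n => ?_)
      simp)
  rw [LSeries_one_eq_riemannZeta hs] at hL
  have h1 := integrableOn_Ioi_cpow_of_lt (show (-s).re < -1 by simpa using hs) one_pos
  have h2 : IntegrableOn (fun x : ℝ => ((Int.fract x : ℝ) : ℂ) * (x : ℂ) ^ (-s - 1)) (Set.Ioi 1) := by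
    have h := integrableOn_Ioi_cpow_of_lt (show (-s - 1).re < -1 by simp; linarith) one_pos
    refine Integrable.mono h ?_ (Filter.Eventually.of_forall fun x => ?_)
    · exact (Complex.measurable_ofReal.comp measurable_fract).aestronglyMeasurable.mul
        h.aestronglyMeasurable
    · rw [norm_mul, Complex.norm_real, Real.norm_of_nonneg (Int.fract_nonneg x)]
      exact mul_le_of_le_one_left (norm_nonneg _) (Int.fract_lt_one x).le
  have h3 : ∫ t in Set.Ioi (1 : ℝ), (∑ k ∈ Finset.Icc 1 ⌊t⌋₊, (1 : ℕ → ℂ) k) * t ^ (-(s + 1)) =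
      ∫ t in Set.Ioi (1 : ℝ), ((t : ℂ) ^ (-s) - ((Int.fract t : ℝ) : ℂ) * (t : ℂ) ^ (-s - 1)) := by
    refine setIntegral_congr_fun measurableSet_Ioi fun x (hx : 1 < x) => ?_
    have hx0 : (x : ℂ) ≠ 0 := by exact_mod_cast (by linarith : x ≠ 0)
    have h4 : ((Int.fract x : ℝ) : ℂ) = x - (⌊x⌋₊ : ℂ) := by
      have := natCast_floor_eq_intCast_floor (R := ℝ) (a := x) (by linarith)
      have h5 := Int.self_sub_floor x
      rw [← this] at h5
      rw [← h5]; push_cast; ring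
    simp only [h4]
    rw [show -(s + 1) = -s - 1 by ring, show (x : ℂ) ^ (-s) = x * (x : ℂ) ^ (-s - 1) by
      rw [Complex.cpow_sub _ _ hx0, Complex.cpow_one]; field_simp]
    simp
    ring
  rw [h3, integral_sub h1 h2, integral_Ioi_cpow_of_lt (by simpa using hs) one_pos] at hL
  rw [hL]
  have : s - 1 ≠ 0 := fun h => by rw [sub_eq_zero.1 h] at hs; simp at hs
  have : -s + 1 ≠ 0 := fun h => this (by linear_combination -h)
  simp only [Complex.ofReal_one, Complex.one_cpow]
  rw [mul_sub, show -1 / (-s + 1) = 1 / (s - 1) by rw [← neg_div_neg_eq]; congr 1 <;> ring]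
  ring

open MeasureTheory ProbabilityTheory Filter Topology in
lemma riemannZeta₁_eq_of_re_pos {s : ℂ} (hs : 0 < s.re) :
    riemannZeta₁ s = s - s * (s - 1) *
      complexMGF (fun x => -Real.log x) (mellinMeasure Int.fract) s := by
  have hint : ∀ t, 0 < t →
      t ∈ interior (integrableExpSet (fun x => -Real.log x) (mellinMeasure Int.fract)) := fun u hu =>
    interior_maximal (fun v hv => mem_integrableExpSet_fract hv) isOpen_Ioi hu
  have hA : AnalyticOnNhd ℂ riemannZeta₁ {z | 0 < z.re} := fun z _ =>
    differentiable_riemannZeta₁.analyticAt z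
  have hB : AnalyticOnNhd ℂ (fun s => s - s * (s - 1) *
      complexMGF (fun x => -Real.log x) (mellinMeasure Int.fract) s) {z | 0 < z.re} := fun z hz => by
    have := analyticAt_complexMGF (hint _ hz)
    fun_prop
  have hpre : IsPreconnected {z : ℂ | 0 < z.re} := (convex_halfSpace_re_gt 0).isPreconnected
  refine hA.eqOn_of_preconnected_of_eventuallyEq hB hpre (z₀ := 2) (by simp) ?_ hs
  have : {z : ℂ | 1 < z.re} ∈ 𝓝 (2 : ℂ) :=
    (isOpen_lt continuous_const Complex.continuous_re).mem_nhds (by simp)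
  filter_upwards [this] with z (hz : 1 < z.re)
  have h1 : z ≠ 1 := fun h => by rw [h] at hz; simp at hz
  have h2 := riemannZeta_eq_of_one_lt_re hz
  rw [riemannZeta_eq_inv_sub_mul h1] at h2
  have h3 : z - 1 ≠ 0 := sub_ne_zero.2 h1
  field_simp at h2
  linear_combination h2

-- On `(0, 1)` the transform of the fractional part enters with the positive coefficient `s (1 -
-- s)`, so the value is at least `s`. Landau's lemma needs this absence of real zeros.
open MeasureTheory ProbabilityTheory in
lemma riemannZeta₁_ofReal_ne_zero {s : ℝ} (hs : 0 < s) : riemannZeta₁ s ≠ 0 := by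
  rcases lt_or_ge s 1 with h1 | h1
  · rw [riemannZeta₁_eq_of_re_pos (by simpa using hs), complexMGF_ofReal]
    have h2 : 0 ≤ mgf (fun x => -Real.log x) (mellinMeasure Int.fract) s := mgf_nonneg
    have h3 : 0 < s - s * (s - 1) * mgf (fun x => -Real.log x) (mellinMeasure Int.fract) s := by
      nlinarith [mul_nonneg (mul_nonneg hs.le (sub_nonneg.2 h1.le)) h2]
    exact_mod_cast h3.ne'
  · rcases eq_or_ne (s : ℂ) 1 with h | h
    · rw [h]; simp
    · have := riemannZeta_ne_zero_of_one_le_re (s := s) (by simpa using h1)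
      rw [riemannZeta_eq_inv_sub_mul h] at this
      exact right_ne_zero_of_mul this

lemma riemannZeta_eq_zero_iff {s : ℂ} (hs : s ≠ 1) : riemannZeta s = 0 ↔ riemannZeta₁ s = 0 := by
  rw [riemannZeta_eq_inv_sub_mul hs]
  simp [sub_ne_zero.2 hs]

lemma riemannHypothesis_of_ne_zero (h : ∀ s : ℂ, 1 / 2 < s.re → riemannZeta₁ s ≠ 0) :
    RiemannHypothesis := by
  intro s hs htriv hs1
  rcases lt_trichotomy s.re (1 / 2) with hlt | heq | hgt
  · exfalso
    have hw : 1 / 2 < (1 - s).re := by simp; linarith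
    have h0 : s ≠ 0 := by
      rintro rfl
      rw [riemannZeta_zero] at hs
      norm_num at hs
    have hw1 : 1 - s ≠ 1 := fun h => h0 (by linear_combination -h)
    have hn : ∀ n : ℕ, 1 - s ≠ -n := by
      intro n hn
      rw [hn] at hw
      have : (0 : ℝ) ≤ n := n.cast_nonneg
      simp at hw
      linarith
    have hfe := riemannZeta_one_sub hn hw1
    rw [sub_sub_cancel, hs] at hfe
    have hz : riemannZeta (1 - s) ≠ 0 := (riemannZeta_eq_zero_iff hw1).not.2 (h _ hw)
    have hG : Complex.Gamma (1 - s) ≠ 0 := Complex.Gamma_ne_zero hn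
    have hpi : (2 * (Real.pi : ℂ)) ≠ 0 := by simp [Real.pi_ne_zero]
    -- In the functional equation only the cosine can vanish, so `s` is an even integer; `Re s <
    -- 1/2` and `ζ(0) ≠ 0` make it a trivial zero.
    have hc : Complex.cos (Real.pi * (1 - s) / 2) = 0 := by
      by_contra hc
      refine mul_ne_zero (mul_ne_zero (mul_ne_zero (mul_ne_zero two_ne_zero ?_) hG) hc) hz hfe.symm
      rw [Complex.cpow_def_of_ne_zero hpi]
      exact Complex.exp_ne_zero _
    obtain ⟨k, hk⟩ := Complex.cos_eq_zero_iff.1 hc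
    have hk2 : s = -2 * k := by
      have hp : (Real.pi : ℂ) ≠ 0 := by simp [Real.pi_ne_zero]
      have : (Real.pi : ℂ) * (1 - s) = Real.pi * (2 * k + 1) := by linear_combination 2 * hk
      linear_combination -(mul_left_cancel₀ hp this)
    rw [hk2] at hlt
    have hk0 : 0 ≤ k := by
      have h5 : (-2 * (k : ℂ)).re = -2 * (k : ℝ) := by simp
      rw [h5] at hlt
      have : (-1 : ℝ) < k := by linarith
      have : (-1 : ℤ) < k := by exact_mod_cast this
      omega
    have hk1 : k ≠ 0 := by rintro rfl; simp at hk2; exact h0 hk2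
    refine htriv ⟨(k - 1).toNat, ?_⟩
    have : (((k - 1).toNat : ℤ) : ℂ) = k - 1 := by
      rw [Int.toNat_of_nonneg (by omega)]; push_cast; ring
    rw [hk2]
    rw [Int.cast_natCast] at this
    rw [this]; ring
  · exact heq
  · exact absurd ((riemannZeta_eq_zero_iff hs1).1 hs) (h s hgt)

/-! ### The Mellin transform of the normalized integral. -/

-- Absolute integrability over the triangle `u ≤ x`, for Fubini: integrating in `x` first leaves `|h
-- u| u ^ (-Re w) / Re w`.
open MeasureTheory in
lemma integrable_prod_indicator_mul_cpow {h : ℝ → ℝ} (hh : Measurable h) {w : ℂ} (hw : 0 < w.re)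
    (hi : IntegrableOn (fun u => h u * u ^ (-w.re)) (Set.Ioi 1)) :
    Integrable ({p : ℝ × ℝ | p.2 ≤ p.1}.indicator fun p => (h p.2 : ℂ) * (p.1 : ℂ) ^ (-w - 1))
      ((volume.restrict (Set.Ioi 1)).prod (volume.restrict (Set.Ioi 1))) := by
  have hmeas : Measurable ({p : ℝ × ℝ | p.2 ≤ p.1}.indicator fun p =>
      (h p.2 : ℂ) * (p.1 : ℂ) ^ (-w - 1)) :=
    Measurable.indicator (by fun_prop) (measurableSet_le measurable_snd measurable_fst)
  have hsec : ∀ u x : ℝ, {p : ℝ × ℝ | p.2 ≤ p.1}.indicator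
      (fun p => (h p.2 : ℂ) * (p.1 : ℂ) ^ (-w - 1)) (x, u) =
      (Set.Ici u).indicator (fun x : ℝ => (h u : ℂ) * (x : ℂ) ^ (-w - 1)) x := fun u x => rfl
  have hre : (-w - 1).re < -1 := by simp; linarith
  have hint : ∀ u : ℝ, 1 < u → IntegrableOn (fun x : ℝ => (h u : ℂ) * (x : ℂ) ^ (-w - 1)) (Set.Ici u) :=
    fun u hu => ((integrableOn_Ici_iff_integrableOn_Ioi).2
      (integrableOn_Ioi_cpow_of_lt hre (by linarith))).const_mul _
  have hsub : ∀ u : ℝ, 1 < u → Set.Ici u ∩ Set.Ioi 1 = Set.Ici u := fun u hu =>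
    Set.inter_eq_left.2 fun x hx => lt_of_lt_of_le hu hx
  rw [integrable_prod_iff' hmeas.aestronglyMeasurable]
  constructor
  · filter_upwards [ae_restrict_mem measurableSet_Ioi] with u (hu : 1 < u)
    simp_rw [hsec]
    rw [integrable_indicator_iff measurableSet_Ici, IntegrableOn, Measure.restrict_restrict
      measurableSet_Ici, hsub u hu]
    exact hint u hu
  · refine (hi.norm.const_mul w.re⁻¹).congr ?_
    filter_upwards [ae_restrict_mem measurableSet_Ioi] with u (hu : 1 < u)
    have hu0 : 0 < u := by linarith
    simp_rw [hsec, norm_indicator_eq_indicator_norm]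
    rw [integral_indicator measurableSet_Ici, Measure.restrict_restrict measurableSet_Ici, hsub u hu,
      integral_Ici_eq_integral_Ioi]
    have : ∀ x ∈ Set.Ioi u, ‖(h u : ℂ) * (x : ℂ) ^ (-w - 1)‖ = |h u| * x ^ (-w.re - 1) := by
      intro x hx
      rw [norm_mul, Complex.norm_real, Complex.norm_cpow_eq_rpow_re_of_pos (hu0.trans hx)]
      simp
    rw [setIntegral_congr_fun measurableSet_Ioi this, integral_const_mul,
      integral_Ioi_rpow_of_lt (by linarith) hu0]
    rw [norm_mul, Real.norm_eq_abs, Real.norm_of_nonneg (by positivity)]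
    simp
    field_simp

open MeasureTheory in
lemma integrableOn_primitive_mul_cpow {h : ℝ → ℝ} (hh : Measurable h) {w : ℂ} (hw : 0 < w.re)
    (hi : IntegrableOn (fun u => h u * u ^ (-w.re)) (Set.Ioi 1)) :
    IntegrableOn (fun x : ℝ => ((∫ u in (1 : ℝ)..x, h u : ℝ) : ℂ) * (x : ℂ) ^ (-w - 1)) (Set.Ioi 1) ∧
    ∫ x in Set.Ioi (1 : ℝ), ((∫ u in (1 : ℝ)..x, h u : ℝ) : ℂ) * (x : ℂ) ^ (-w - 1) =
      w⁻¹ * ∫ u in Set.Ioi (1 : ℝ), (h u : ℂ) * (u : ℂ) ^ (-w) := by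
  have hP := integrable_prod_indicator_mul_cpow hh hw hi
  have hre : (-w - 1).re < -1 := by simp; linarith
  have hin : ∀ x ∈ Set.Ioi (1 : ℝ), ∫ u in Set.Ioi (1 : ℝ), {p : ℝ × ℝ | p.2 ≤ p.1}.indicator
      (fun p => (h p.2 : ℂ) * (p.1 : ℂ) ^ (-w - 1)) (x, u) =
      ((∫ u in (1 : ℝ)..x, h u : ℝ) : ℂ) * (x : ℂ) ^ (-w - 1) := by
    intro x (hx : 1 < x)
    have : ∀ u : ℝ, {p : ℝ × ℝ | p.2 ≤ p.1}.indicator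
      (fun p => (h p.2 : ℂ) * (p.1 : ℂ) ^ (-w - 1)) (x, u) =
      (Set.Iic x).indicator (fun u : ℝ => (h u : ℂ) * (x : ℂ) ^ (-w - 1)) u := fun u => rfl
    simp_rw [this]
    rw [integral_indicator measurableSet_Iic, Measure.restrict_restrict measurableSet_Iic,
      Set.inter_comm, Set.Ioi_inter_Iic, integral_mul_const, intervalIntegral.integral_of_le hx.le,
      integral_complex_ofReal]
  have hout : ∀ u ∈ Set.Ioi (1 : ℝ), ∫ x in Set.Ioi (1 : ℝ), {p : ℝ × ℝ | p.2 ≤ p.1}.indicator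
      (fun p => (h p.2 : ℂ) * (p.1 : ℂ) ^ (-w - 1)) (x, u) =
      w⁻¹ * ((h u : ℂ) * (u : ℂ) ^ (-w)) := by
    intro u (hu : 1 < u)
    have : ∀ x : ℝ, {p : ℝ × ℝ | p.2 ≤ p.1}.indicator
      (fun p => (h p.2 : ℂ) * (p.1 : ℂ) ^ (-w - 1)) (x, u) =
      (Set.Ici u).indicator (fun x : ℝ => (h u : ℂ) * (x : ℂ) ^ (-w - 1)) x := fun u => rfl
    have hsub : Set.Ici u ∩ Set.Ioi 1 = Set.Ici u :=
      Set.inter_eq_left.2 fun x hx => lt_of_lt_of_le hu hx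
    simp_rw [this]
    rw [integral_indicator measurableSet_Ici, Measure.restrict_restrict measurableSet_Ici,
      hsub, integral_Ici_eq_integral_Ioi,
      integral_const_mul, integral_Ioi_cpow_of_lt hre (by linarith)]
    have hw0 : w ≠ 0 := fun h => by simp [h] at hw
    rw [sub_add_cancel]
    field_simp
  constructor
  · exact (integrableOn_congr_fun hin measurableSet_Ioi).1 hP.integral_prod_left
  · rw [← setIntegral_congr_fun measurableSet_Ioi hin]
    refine (integral_integral_swap
      (f := Function.curry ({p : ℝ × ℝ | p.2 ≤ p.1}.indicator fun p =>
        (h p.2 : ℂ) * (p.1 : ℂ) ^ (-w - 1))) hP).trans ?_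
    rw [← integral_const_mul]
    exact setIntegral_congr_fun measurableSet_Ioi hout

lemma measurable_mertens : Measurable mertens :=
  (measurable_from_nat (f := fun n : ℕ => ∑ k ∈ Finset.Icc 1 n,
    (ArithmeticFunction.moebius k : ℝ))).comp Nat.measurable_floor

lemma abs_mertens_le {x : ℝ} (hx : 0 ≤ x) : |mertens x| ≤ x := by
  refine (Finset.abs_sum_le_sum_abs _ _).trans ?_
  refine (Finset.sum_le_sum (g := fun _ => (1 : ℝ)) fun n _ => ?_).trans ?_
  · exact_mod_cast ArithmeticFunction.abs_moebius_le_one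
  · simpa using Nat.floor_le hx

open MeasureTheory in
lemma integral_mertens_mul_cpow {s : ℂ} (hs : 1 < s.re) :
    ∫ u in Set.Ioi (1 : ℝ), (mertens u : ℂ) * (u : ℂ) ^ (-(s + 1)) = (s * riemannZeta s)⁻¹ := by
  have hs0 : s ≠ 0 := fun h => by rw [h] at hs; norm_num at hs
  have hL := LSeries_eq_mul_integral (fun n => ((ArithmeticFunction.moebius n : ℤ) : ℂ)) zero_le_one hs
    (ArithmeticFunction.LSeriesSummable_moebius_iff.2 hs) (by
      refine Asymptotics.IsBigO.of_bound 1 (Filter.Eventually.of_forall fun n => ?_)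
      have := abs_mertens_le (x := n) n.cast_nonneg
      rw [mertens, Nat.floor_natCast] at this
      rw [← Real.norm_eq_abs, ← Complex.norm_real] at this
      push_cast at this
      simpa using this)
  have h1 := ArithmeticFunction.LSeries_zeta_mul_Lseries_moebius hs
  rw [ArithmeticFunction.LSeries_zeta_eq_riemannZeta hs, hL] at h1
  have h2 : ∀ u : ℝ, (mertens u : ℂ) = ∑ k ∈ Finset.Icc 1 ⌊u⌋₊,
      ((ArithmeticFunction.moebius k : ℤ) : ℂ) := fun u => by simp [mertens]
  simp_rw [h2]
  refine eq_inv_of_mul_eq_one_left ?_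
  linear_combination h1

open MeasureTheory in
lemma integrableOn_mertens_div_rpow {κ a : ℝ} (ha : 2 < κ + a) :
    IntegrableOn (fun u => mertens u / u ^ κ * u ^ (-a)) (Set.Ioi 1) := by
  have h := integrableOn_Ioi_rpow_of_lt (show 1 - κ - a < -1 by linarith) one_pos
  have hm := measurable_mertens
  refine Integrable.mono' h (Measurable.aestronglyMeasurable (by fun_prop)) ?_
  filter_upwards [ae_restrict_mem measurableSet_Ioi] with u (hu : 1 < u)
  have hu0 : 0 < u := by linarith
  rw [norm_mul, norm_div, Real.norm_eq_abs, Real.norm_of_nonneg (Real.rpow_nonneg hu0.le _),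
    Real.norm_of_nonneg (Real.rpow_nonneg hu0.le _), Real.rpow_sub hu0, Real.rpow_sub hu0,
    Real.rpow_neg hu0.le, Real.rpow_one, ← div_eq_mul_inv]
  gcongr
  exact abs_mertens_le hu0.le

open MeasureTheory in
/-- The Mellin-type transform of the normalized integral. -/
lemma integral_normalizedIntegral_mul_cpow {κ : ℝ} (hκ : κ ≤ 3 / 2) {z : ℂ} (hz : 1 / 2 < z.re) :
    IntegrableOn (fun x : ℝ => (normalizedIntegral κ x : ℂ) * (x : ℂ) ^ (-z - 1)) (Set.Ioi 1) ∧
    ∫ x in Set.Ioi (1 : ℝ), (normalizedIntegral κ x : ℂ) * (x : ℂ) ^ (-z - 1) =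
      ((z + (3 / 2 - κ : ℝ)) * ((z + 1 / 2) * riemannZeta (z + 1 / 2)))⁻¹ := by
  set w : ℂ := z + (3 / 2 - κ : ℝ) with hw
  have hwre : w.re = z.re + (3 / 2 - κ) := by simp [hw]
  have hm := measurable_mertens
  obtain ⟨h1, h2⟩ := integrableOn_primitive_mul_cpow (h := fun u => mertens u / u ^ κ) (w := w)
    (by fun_prop) (by rw [hwre]; linarith) (integrableOn_mertens_div_rpow (by rw [hwre]; linarith))
  have h3 : ∀ x ∈ Set.Ioi (1 : ℝ),
      ((∫ u in (1 : ℝ)..x, mertens u / u ^ κ : ℝ) : ℂ) * (x : ℂ) ^ (-w - 1) =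
      (normalizedIntegral κ x : ℂ) * (x : ℂ) ^ (-z - 1) := by
    intro x (hx : 1 < x)
    have hx0 : 0 < x := by linarith
    have hx1 : (x : ℂ) ≠ 0 := by exact_mod_cast hx0.ne'
    rw [normalizedIntegral, one_div, ← Real.rpow_neg hx0.le, Complex.ofReal_mul,
      Complex.ofReal_cpow hx0.le, show -w - 1 = ((-(3 / 2 - κ) : ℝ) : ℂ) + (-z - 1) by
        rw [hw]; push_cast; ring, Complex.cpow_add _ _ hx1]
    ring
  rw [integrableOn_congr_fun h3 measurableSet_Ioi] at h1
  rw [setIntegral_congr_fun measurableSet_Ioi h3] at h2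
  refine ⟨h1, ?_⟩
  rw [h2, mul_inv w]
  congr 1
  rw [← integral_mertens_mul_cpow (by simp; linarith)]
  refine setIntegral_congr_fun measurableSet_Ioi fun u (hu : 1 < u) => ?_
  have hu0 : 0 < u := by linarith
  have hu1 : (u : ℂ) ≠ 0 := by exact_mod_cast hu0.ne'
  rw [Complex.ofReal_div, Complex.ofReal_cpow hu0.le, div_mul_eq_mul_div, mul_div_assoc,
    ← Complex.cpow_sub _ _ hu1]
  congr 2
  rw [hw]; push_cast; ring

open MeasureTheory in
lemma exists_abs_normalizedIntegral_le {κ : ℝ} (hκ : κ ≤ 3 / 2) (X : ℝ) :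
    ∃ K, ∀ x, 1 ≤ x → x ≤ X → |normalizedIntegral κ x| ≤ K := by
  have hi : IntegrableOn (fun u => mertens u / u ^ κ) (Set.Ioc 1 X) := by
    -- Any exponent above `2 - κ` would do; the weight is removed again on the bounded interval.
    have h1 := (integrableOn_mertens_div_rpow (κ := κ) (a := 3 - κ) (by linarith)).mono_set
      (Set.Ioc_subset_Ioi_self : Set.Ioc 1 X ⊆ _)
    have h2 := h1.mul_continuousOn_of_subset (g' := fun u : ℝ => u ^ (3 - κ)) (K := Set.Icc 1 X)
      (fun u hu => (Real.continuousAt_rpow_const _ _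
        (Or.inl (by linarith [hu.1] : u ≠ 0))).continuousWithinAt)
      measurableSet_Ioc isCompact_Icc Set.Ioc_subset_Icc_self
    refine (integrableOn_congr_fun (fun u hu => ?_) measurableSet_Ioc).1 h2
    have hu0 : 0 < u := by linarith [hu.1]
    rw [mul_assoc, ← Real.rpow_add hu0]
    simp
  refine ⟨∫ u in Set.Ioc 1 X, |mertens u / u ^ κ|, fun x hx hxX => ?_⟩
  have hx0 : 0 < x := by linarith
  rw [normalizedIntegral, abs_mul, intervalIntegral.integral_of_le hx]
  have h3 : |1 / x ^ (3 / 2 - κ)| ≤ 1 := by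
    rw [abs_of_nonneg (by positivity), div_le_one (by positivity)]
    exact Real.one_le_rpow hx (by linarith)
  refine (mul_le_of_le_one_left (abs_nonneg _) h3).trans ?_
  refine abs_integral_le_integral_abs.trans ?_
  refine setIntegral_mono_set hi.abs (Filter.Eventually.of_forall fun u => abs_nonneg _) ?_
  exact (Set.Ioc_subset_Ioc_right hxX).eventuallyLE

/-- The term `B / x` absorbs the bounded initial range where the bound may fail. Its transform has a
pole only at `z = -1`, so it does not affect residues on the imaginary axis. -/
lemma exists_nonneg_of_eventually_le {κ : ℝ} (hκ : κ ≤ 3 / 2) {ε C : ℝ} (hε : |ε| = 1)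
    (h : ∀ᶠ x in Filter.atTop, ε * normalizedIntegral κ x ≤ C) :
    ∃ B : ℝ, ∀ x, 1 < x → 0 ≤ C + B / x - ε * normalizedIntegral κ x := by
  obtain ⟨X, hX⟩ := Filter.eventually_atTop.1 h
  obtain ⟨K, hK⟩ := exists_abs_normalizedIntegral_le hκ X
  refine ⟨|X| * (|K| + |C|), fun x hx => ?_⟩
  have hx0 : 0 < x := by linarith
  have h0 : 0 ≤ |X| * (|K| + |C|) / x := by positivity
  rcases le_or_gt X x with hXx | hXx
  · linarith [hX x hXx]
  · have h1 : |K| + |C| ≤ |X| * (|K| + |C|) / x := by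
      rw [le_div_iff₀ hx0, mul_comm]
      exact mul_le_mul_of_nonneg_right (hXx.le.trans (le_abs_self X)) (by positivity)
    have h2 := (le_abs_self _).trans_eq (abs_mul ε (normalizedIntegral κ x))
    rw [hε, one_mul] at h2
    linarith [hK x hx.le hXx.le, le_abs_self K, neg_abs_le C]

open MeasureTheory in
lemma aemeasurable_normalizedIntegral {κ : ℝ} (hκ : κ ≤ 3 / 2) :
    AEMeasurable (normalizedIntegral κ) (volume.restrict (Set.Ioi 1)) := by
  have h1 := (integral_normalizedIntegral_mul_cpow hκ (z := 1) (by norm_num)).1.aestronglyMeasurable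
  have h2 : AEMeasurable (fun x : ℝ => ((normalizedIntegral κ x : ℂ) * (x : ℂ) ^ (-(1 : ℂ) - 1) *
      (x : ℂ) ^ (2 : ℂ)).re) (volume.restrict (Set.Ioi 1)) :=
    Complex.measurable_re.comp_aemeasurable (h1.aemeasurable.mul (by fun_prop))
  refine h2.congr ?_
  filter_upwards [ae_restrict_mem measurableSet_Ioi] with x (hx : 1 < x)
  have hx1 : (x : ℂ) ≠ 0 := by exact_mod_cast (by linarith : x ≠ 0)
  rw [mul_assoc, ← Complex.cpow_add _ _ hx1]
  norm_num

/-! ### A one-sided bound excludes zeros with `Re z > 0`. -/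

/-- The entire function `(z + 3/2 - κ) (z + 1/2) (s - 1) ζ(s)`, where `s = z + 1/2`. -/
noncomputable def mertensDenom (κ : ℝ) (z : ℂ) : ℂ :=
  (z + (3 / 2 - κ : ℝ)) * ((z + 1 / 2) * riemannZeta₁ (z + 1 / 2))

lemma differentiable_mertensDenom (κ : ℝ) : Differentiable ℂ (mertensDenom κ) := by
  have := differentiable_riemannZeta₁
  unfold mertensDenom
  fun_prop

lemma mertensDenom_ofReal_ne_zero {κ : ℝ} (hκ : κ ≤ 3 / 2) {t : ℝ} (ht : 0 < t) :
    mertensDenom κ t ≠ 0 := by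
  have h1 : ((t + 1 / 2 : ℝ) : ℂ) ≠ 0 := by exact_mod_cast (by linarith : t + 1 / 2 ≠ 0)
  have h2 : ((t + (3 / 2 - κ) : ℝ) : ℂ) ≠ 0 := by exact_mod_cast (by linarith : t + (3 / 2 - κ) ≠ 0)
  have h3 := riemannZeta₁_ofReal_ne_zero (show 0 < t + 1 / 2 by linarith)
  have h4 : (t : ℂ) + 1 / 2 = ((t + 1 / 2 : ℝ) : ℂ) := by push_cast; ring
  rw [mertensDenom, h4, ← Complex.ofReal_add]
  exact mul_ne_zero h2 (mul_ne_zero h1 h3)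

section upperBound

open MeasureTheory ProbabilityTheory Filter Topology Complex

variable {κ ε C B : ℝ}

/-- The measure with density `C + B / x - ε N(x)` with respect to `dx / x` on `(1, ∞)`,
where `N` is the normalized integral. -/
noncomputable def boundMeasure (κ ε C B : ℝ) : Measure ℝ :=
  mellinMeasure fun x => C + B / x - ε * normalizedIntegral κ x

lemma aemeasurable_bound (hκ : κ ≤ 3 / 2) :
    AEMeasurable (fun x => C + B / x - ε * normalizedIntegral κ x) (volume.restrict (Set.Ioi 1)) := by
  have := aemeasurable_normalizedIntegral hκ
  fun_prop

lemma complexMGF_boundMeasure_aux (hκ : κ ≤ 3 / 2)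
    (h0 : ∀ x, 1 < x → 0 ≤ C + B / x - ε * normalizedIntegral κ x) {z : ℂ} (hz : 1 / 2 < z.re) :
    z.re ∈ integrableExpSet (fun x => -Real.log x) (boundMeasure κ ε C B) ∧
    complexMGF (fun x => -Real.log x) (boundMeasure κ ε C B) z =
      C / z + B / (z + 1) - ε * ((z - 1 / 2) / mertensDenom κ z) := by
  have hz0 : z ≠ 0 := fun h => by rw [h] at hz; norm_num at hz
  have hz1 : z + 1 ≠ 0 := fun h => by
    rw [eq_neg_of_add_eq_zero_left h] at hz; norm_num at hz
  obtain ⟨hN1, hN2⟩ := integral_normalizedIntegral_mul_cpow hκ hz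
  have hI1 := integrableOn_Ioi_cpow_of_lt (show (-z - 1).re < -1 by simp; linarith) one_pos
  have hI2 := integrableOn_Ioi_cpow_of_lt (show (-z - 2).re < -1 by simp; linarith) one_pos
  have hfun : ∀ x ∈ Set.Ioi (1 : ℝ), ((C + B / x - ε * normalizedIntegral κ x : ℝ) : ℂ) *
      (x : ℂ) ^ (-z - 1) = C * (x : ℂ) ^ (-z - 1) + B * (x : ℂ) ^ (-z - 2) -
        ε * ((normalizedIntegral κ x : ℂ) * (x : ℂ) ^ (-z - 1)) := by
    intro x (hx : 1 < x)
    have hx1 : (x : ℂ) ≠ 0 := by exact_mod_cast (by linarith : x ≠ 0)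
    rw [show -z - 2 = (-z - 1) - 1 by ring, cpow_sub (-z - 1) 1 hx1, cpow_one]
    generalize (x : ℂ) ^ (-z - 1) = y
    push_cast
    field_simp
  have hI3 : IntegrableOn (fun x : ℝ => C * (x : ℂ) ^ (-z - 1) + B * (x : ℂ) ^ (-z - 2))
      (Set.Ioi 1) := (hI1.const_mul (C : ℂ)).add (hI2.const_mul (B : ℂ))
  have hint := hI3.sub (hN1.const_mul (ε : ℂ))
  constructor
  · rw [boundMeasure, mem_integrableExpSet_mellinMeasure (aemeasurable_bound hκ) h0]
    have h1 : IntegrableOn (fun x : ℝ => ((C + B / x - ε * normalizedIntegral κ x : ℝ) : ℂ) *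
      (x : ℂ) ^ (-z - 1)) (Set.Ioi 1) := (integrableOn_congr_fun hfun measurableSet_Ioi).2 hint
    refine (integrableOn_congr_fun (fun x (hx : 1 < x) => ?_) measurableSet_Ioi).1 h1.norm
    rw [norm_mul, norm_real, Real.norm_of_nonneg (h0 x hx),
      norm_cpow_eq_rpow_re_of_pos (by linarith)]
    simp
  · rw [boundMeasure, complexMGF_mellinMeasure (aemeasurable_bound hκ) h0,
      setIntegral_congr_fun measurableSet_Ioi hfun, integral_sub
        hI3 (hN1.const_mul (ε : ℂ)),
      integral_add (hI1.const_mul (C : ℂ)) (hI2.const_mul (B : ℂ)), integral_const_mul,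
      integral_const_mul, integral_const_mul, hN2,
      integral_Ioi_cpow_of_lt (by simp; linarith) one_pos,
      integral_Ioi_cpow_of_lt (by simp; linarith) one_pos]
    have e1 : -z - 1 + 1 = -z := by ring
    have e2 : -z - 2 + 1 = -(z + 1) := by ring
    have e3 : ((z + (3 / 2 - κ : ℝ)) * ((z + 1 / 2) * riemannZeta (z + 1 / 2)))⁻¹ =
        (z - 1 / 2) / mertensDenom κ z := by
      have hz2 : z + 1 / 2 ≠ 1 := fun h => by
        have : z = 1 / 2 := by linear_combination h
        rw [this] at hz; norm_num at hz
      rw [riemannZeta_eq_inv_sub_mul hz2, mertensDenom, show z + 1 / 2 - 1 = z - 1 / 2 by ring]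
      simp only [mul_inv, inv_inv, div_eq_mul_inv]
      ring
    rw [e1, e2, e3]
    simp only [ofReal_one, one_cpow, neg_div_neg_eq]
    ring

lemma mertensDenom_ne_zero_and_complexMGF_boundMeasure (hκ : κ ≤ 3 / 2) (hε : |ε| = 1)
    (h0 : ∀ x, 1 < x → 0 ≤ C + B / x - ε * normalizedIntegral κ x) :
    (∀ t, 0 < t → t ∈ integrableExpSet (fun x => -Real.log x) (boundMeasure κ ε C B)) ∧
    (∀ z : ℂ, 0 < z.re → mertensDenom κ z ≠ 0) ∧
    ∀ z : ℂ, 0 < z.re → complexMGF (fun x => -Real.log x) (boundMeasure κ ε C B) z =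
      C / z + B / (z + 1) - ε * ((z - 1 / 2) / mertensDenom κ z) := by
  have hD := differentiable_mertensDenom κ
  have hε0 : (ε : ℂ) ≠ 0 := by
    intro h
    rw [ofReal_eq_zero] at h
    simp [h] at hε
  have hz1 : ∀ z : ℂ, 0 < z.re → z ≠ 0 ∧ z + 1 ≠ 0 := by
    intro z hz
    refine ⟨fun h => by rw [h] at hz; norm_num at hz, fun h => ?_⟩
    rw [eq_neg_of_add_eq_zero_left h] at hz; norm_num at hz
  have hDr : ∀ z : ℂ, 1 / 2 < z.re → mertensDenom κ z ≠ 0 := by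
    intro z hz
    have h1 : z + 1 / 2 ≠ 1 := fun h => by
      have : z = 1 / 2 := by linear_combination h
      rw [this] at hz; norm_num at hz
    have h2 : riemannZeta₁ (z + 1 / 2) ≠ 0 := (riemannZeta_eq_zero_iff h1).not.1
      (riemannZeta_ne_zero_of_one_le_re (by simp; linarith))
    refine mul_ne_zero (fun h => ?_) (mul_ne_zero (fun h => ?_) h2)
    · have := congr_arg re h; simp at this; linarith
    · have := congr_arg re h; simp at this; linarith
  obtain ⟨h1, h2⟩ := complexMGF_continuation (μ := boundMeasure κ ε C B) (X := fun x => -Real.log x)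
    aemeasurable_neg_log_mellinMeasure neg_log_nonpos_ae_mellinMeasure (b := 1 / 2)
    (P := fun z => (C * (z + 1) + B * z) * mertensDenom κ z - ε * (z * (z + 1) * (z - 1 / 2)))
    (Q := fun z => z * (z + 1) * mertensDenom κ z) (by fun_prop) (by fun_prop)
    (fun t ht => mul_ne_zero (mul_ne_zero (hz1 t (by simpa using ht)).1 (hz1 t (by simpa using ht)).2)
      (mertensDenom_ofReal_ne_zero hκ ht))
    (fun t ht => by
      simpa using (complexMGF_boundMeasure_aux hκ h0 (z := t) (by simpa using ht)).1)
    (fun z hz => by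
      rw [(complexMGF_boundMeasure_aux hκ h0 hz).2]
      obtain ⟨h3, h4⟩ := hz1 z (by linarith)
      have := hDr z hz
      field_simp)
  -- At a zero of the denominator the continued identity leaves `z (z + 1) (z - 1/2) = 0`, hence `z
  -- = 1/2`, which is real and positive and so not a zero.
  have hDne : ∀ z : ℂ, 0 < z.re → mertensDenom κ z ≠ 0 := by
    intro z hz hDz
    have h3 := h2 z hz
    simp only [hDz, mul_zero, zero_mul, zero_sub] at h3
    have h4 : z - 1 / 2 = 0 := by
      have := neg_eq_zero.1 h3.symm
      simpa [hε0, hz1 z hz] using this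
    rw [sub_eq_zero] at h4
    rw [h4] at hDz
    have := mertensDenom_ofReal_ne_zero hκ (show (0 : ℝ) < 1 / 2 by norm_num)
    push_cast at this
    exact this hDz
  refine ⟨h1, hDne, fun z hz => ?_⟩
  have h3 := h2 z hz
  obtain ⟨h4, h5⟩ := hz1 z hz
  have h6 := hDne z hz
  refine mul_left_cancel₀ (mul_ne_zero (mul_ne_zero h4 h5) h6) (h3.trans ?_)
  field_simp

end upperBound

/-! ### Simplicity of the zeros on the imaginary axis. -/

lemma riemannZeta₁_eq {s : ℂ} (hs : s ≠ 1) : riemannZeta₁ s = (s - 1) * riemannZeta s := by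
  rw [riemannZeta_eq_inv_sub_mul hs, mul_inv_cancel_left₀ (sub_ne_zero.2 hs)]

lemma deriv_riemannZeta₁_of_eq_zero {s : ℂ} (hs : s ≠ 1) (h0 : riemannZeta s = 0) :
    deriv riemannZeta₁ s = (s - 1) * deriv riemannZeta s := by
  rw [deriv_riemannZeta_eq_neg_inv_sub_sq_mul_add hs, (riemannZeta_eq_zero_iff hs).1 h0, mul_zero,
    zero_add, mul_inv_cancel_left₀ (sub_ne_zero.2 hs)]

lemma hasDerivAt_mertensDenom (κ : ℝ) (z : ℂ) :
    HasDerivAt (mertensDenom κ) ((z + 1 / 2) * riemannZeta₁ (z + 1 / 2) + (z + (3 / 2 - κ : ℝ)) *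
      (riemannZeta₁ (z + 1 / 2) + (z + 1 / 2) * deriv riemannZeta₁ (z + 1 / 2))) z := by
  have h1 : HasDerivAt (fun z => riemannZeta₁ (z + 1 / 2)) (deriv riemannZeta₁ (z + 1 / 2)) z :=
    HasDerivAt.comp_add_const _ _ (differentiable_riemannZeta₁ _).hasDerivAt
  have h2 := ((hasDerivAt_id z).add_const (1 / 2 : ℂ)).mul h1
  have h3 := ((hasDerivAt_id z).add_const ((3 / 2 - κ : ℝ) : ℂ)).mul h2
  refine h3.congr_deriv ?_
  simp

section upperBound

open MeasureTheory ProbabilityTheory Filter Topology Complex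

variable {κ ε C B : ℝ}

lemma ofReal_mul_I_add_ne_zero {t a : ℝ} (h : t ≠ 0 ∨ a ≠ 0) : (t : ℂ) * I + a ≠ 0 := by
  intro h0
  have h1 := congr_arg re h0
  have h2 := congr_arg im h0
  simp at h1 h2
  rcases h with h | h
  · exact h h2
  · exact h h1

lemma tendsto_mul_const_div (C t : ℝ) :
    Tendsto (fun σ : ℝ => (σ : ℂ) * (C / (σ + t * I))) (𝓝[>] 0) (𝓝 (if t = 0 then C else 0)) := by
  split_ifs with ht
  · subst ht
    refine tendsto_const_nhds.congr' ?_
    filter_upwards [self_mem_nhdsWithin] with σ (hσ : 0 < σ)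
    have : (σ : ℂ) ≠ 0 := by exact_mod_cast hσ.ne'
    simp only [ofReal_zero, zero_mul, add_zero]
    field_simp
  · exact tendsto_mul_div_of_ne_zero (D := fun z => z) (E := fun _ => (C : ℂ)) continuous_id
      continuous_const (by simp [ht])

lemma tendsto_mul_const_div_add_one (B t : ℝ) :
    Tendsto (fun σ : ℝ => (σ : ℂ) * (B / (σ + t * I + 1))) (𝓝[>] 0) (𝓝 0) :=
  tendsto_mul_div_of_ne_zero (D := fun z => z + 1) (E := fun _ => (B : ℂ)) (by fun_prop)
    continuous_const (by
      have := ofReal_mul_I_add_ne_zero (t := t) (a := 1) (Or.inr one_ne_zero)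
      simpa using this)

open Classical in
/-- The residue of the transform of the normalized integral at a point `it` of the imaginary axis
which is at most a simple pole. -/
noncomputable def mertensResidue (κ t : ℝ) : ℂ :=
  if mertensDenom κ (t * I) = 0 then (t * I - 1 / 2) / deriv (mertensDenom κ) (t * I) else 0

lemma tendsto_mul_div_mertensDenom {t : ℝ}
    (ht : mertensDenom κ (t * I) = 0 → deriv (mertensDenom κ) (t * I) ≠ 0) :
    Tendsto (fun σ : ℝ => (σ : ℂ) * (((σ + t * I) - 1 / 2) / mertensDenom κ (σ + t * I))) (𝓝[>] 0)
      (𝓝 (mertensResidue κ t)) := by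
  have hD := differentiable_mertensDenom κ
  rw [mertensResidue]
  split_ifs with h
  · exact tendsto_mul_div_of_deriv_ne_zero (E := fun z => z - 1 / 2) hD (by fun_prop) h (ht h)
  · exact tendsto_mul_div_of_ne_zero (E := fun z => z - 1 / 2) hD.continuous (by fun_prop) h

lemma riemannZeta₁_half_ne_zero : riemannZeta₁ (1 / 2) ≠ 0 := by
  have := riemannZeta₁_ofReal_ne_zero (show (0 : ℝ) < 1 / 2 by norm_num)
  push_cast at this
  exact this

lemma deriv_mertensDenom_zero_ne_zero (h : mertensDenom κ ((0 : ℝ) * I) = 0) :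
    κ = 3 / 2 ∧ deriv (mertensDenom κ) ((0 : ℝ) * I) = 1 / 2 * riemannZeta₁ (1 / 2) := by
  have h1 := riemannZeta₁_half_ne_zero
  simp only [mertensDenom, ofReal_zero, zero_mul, zero_add] at h
  have h2 : ((3 / 2 - κ : ℝ) : ℂ) = 0 :=
    (mul_eq_zero.1 h).resolve_right (mul_ne_zero (by norm_num) h1)
  rw [(hasDerivAt_mertensDenom κ _).deriv, h2]
  rw [ofReal_eq_zero] at h2
  exact ⟨by linarith, by simp⟩

/-- Positivity of the measure gives `‖G (σ + it)‖ ≤ G σ`, and `σ G(σ)` stays bounded since a zero at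
the origin is simple. A multiple zero at `it` would then force `it = 1/2`. -/
lemma deriv_mertensDenom_ne_zero (hκ : κ ≤ 3 / 2) (hε : |ε| = 1)
    (h0 : ∀ x, 1 < x → 0 ≤ C + B / x - ε * normalizedIntegral κ x) {t : ℝ}
    (ht : mertensDenom κ (t * I) = 0) : deriv (mertensDenom κ) (t * I) ≠ 0 := by
  obtain ⟨hint, hDne, hG⟩ := mertensDenom_ne_zero_and_complexMGF_boundMeasure hκ hε h0
  have hD := differentiable_mertensDenom κ
  have hz : ∀ h : mertensDenom κ ((0 : ℝ) * I) = 0, deriv (mertensDenom κ) ((0 : ℝ) * I) ≠ 0 := by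
    intro h
    rw [(deriv_mertensDenom_zero_ne_zero h).2]
    exact mul_ne_zero (by norm_num) riemannZeta₁_half_ne_zero
  intro hd
  set G := complexMGF (fun x => -Real.log x) (boundMeasure κ ε C B) with hGdef
  have hre : ∀ σ t : ℝ, ((σ : ℂ) + t * I).re = σ := fun σ t => by simp
  have hGlim : Tendsto (fun σ : ℝ => (σ : ℂ) * G σ) (𝓝[>] 0)
      (𝓝 ((if (0 : ℝ) = 0 then C else 0 : ℝ) + 0 - ε * mertensResidue κ 0)) := by
    have := ((tendsto_mul_const_div C 0).add (tendsto_mul_const_div_add_one B 0)).sub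
      ((tendsto_mul_div_mertensDenom (κ := κ) hz).const_mul (ε : ℂ))
    simp only [if_true] at this ⊢
    refine this.congr' ?_
    filter_upwards [self_mem_nhdsWithin] with σ (hσ : 0 < σ)
    have := hG (σ + (0 : ℝ) * I) (by rw [hre]; exact hσ)
    simp only [ofReal_zero, zero_mul, add_zero] at this ⊢
    rw [this]; ring
  have hU := ((tendsto_mul_const_div C t).norm.add (tendsto_mul_const_div_add_one B t).norm).add
    hGlim.norm
  obtain ⟨K, hK⟩ := hU.isBoundedUnder_le
  rw [eventually_map] at hK
  have hE := eq_zero_of_deriv_eq_zero (E := fun z => z - 1 / 2) hD (by fun_prop) (K := K) ht hd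
    (fun σ hσ => hDne _ (by rw [hre]; exact hσ)) ?_
  · have := congr_arg re hE
    norm_num at this
  · filter_upwards [hK, self_mem_nhdsWithin] with σ hσK (hσ : 0 < σ)
    refine le_trans ?_ hσK
    have h1 := hG (σ + t * I) (by rw [hre]; exact hσ)
    have h2 : ‖G (σ + t * I)‖ ≤ ‖G σ‖ := by
      refine norm_complexMGF_le_mgf.trans ?_
      rw [hre, hGdef, complexMGF_ofReal, norm_real]
      exact le_abs_self _
    have h3 : ‖(σ : ℂ) * (((σ + t * I) - 1 / 2) / mertensDenom κ (σ + t * I))‖ =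
        ‖(σ : ℂ) * (C / (σ + t * I)) + σ * (B / (σ + t * I + 1)) - σ * G (σ + t * I)‖ := by
      rw [h1, show (σ : ℂ) * (C / (σ + t * I)) + σ * (B / (σ + t * I + 1)) -
        σ * (C / (σ + t * I) + B / (σ + t * I + 1) -
          ε * (((σ + t * I) - 1 / 2) / mertensDenom κ (σ + t * I))) =
        ε * (σ * (((σ + t * I) - 1 / 2) / mertensDenom κ (σ + t * I))) by ring, norm_mul (ε : ℂ),
        norm_real, Real.norm_eq_abs, hε, one_mul]
    rw [h3]
    refine (norm_sub_le _ _).trans (add_le_add (norm_add_le _ _) ?_)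
    rw [norm_mul, norm_mul]
    gcongr

lemma tendsto_mul_complexMGF_boundMeasure (hκ : κ ≤ 3 / 2) (hε : |ε| = 1)
    (h0 : ∀ x, 1 < x → 0 ≤ C + B / x - ε * normalizedIntegral κ x) (t : ℝ) :
    Tendsto (fun σ : ℝ => (σ : ℂ) *
      complexMGF (fun x => -Real.log x) (boundMeasure κ ε C B) (σ + t * I)) (𝓝[>] 0)
      (𝓝 ((if t = 0 then (C : ℂ) else 0) - ε * mertensResidue κ t)) := by
  have := ((tendsto_mul_const_div C t).add (tendsto_mul_const_div_add_one B t)).sub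
    ((tendsto_mul_div_mertensDenom (κ := κ) (t := t) fun h =>
      deriv_mertensDenom_ne_zero hκ hε h0 h).const_mul (ε : ℂ))
  rw [add_zero] at this
  refine this.congr' ?_
  filter_upwards [self_mem_nhdsWithin] with σ (hσ : 0 < σ)
  rw [(mertensDenom_ne_zero_and_complexMGF_boundMeasure hκ hε h0).2.2 (σ + t * I) (by simpa using hσ)]
  ring

end upperBound

/-! ### Integer relations between independent ordinates. -/

lemma LinearIndependent.eq_single_of_sum_int_mul {V : Type*} [DecidableEq V] {v : V → ℝ}
    (hv : LinearIndependent ℚ v) {S : Finset V} {p : S → ℤ} {k : ℤ} (hk : k ≠ 0) {ρ : V}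
    (h : ∑ j, (p j : ℝ) * v j = k * v ρ) : ∃ j, p = Pi.single j k := by
  -- Comparing finitely supported functions on all of `V` covers the case where `ρ` is not known to
  -- lie in `S`.
  set l : V →₀ ℚ := ∑ j : S, Finsupp.single (j : V) (p j : ℚ) with hl
  have h1 : l = Finsupp.single ρ (k : ℚ) := by
    apply hv
    rw [hl, map_sum]
    simp only [Finsupp.linearCombination_single, Rat.smul_def]
    push_cast
    exact h
  have hle : ∀ u : V, l u = if hu : u ∈ S then (p ⟨u, hu⟩ : ℚ) else 0 := by
    intro u
    rw [hl, Finsupp.finsetSum_apply]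
    split_ifs with hu
    · rw [Finset.sum_eq_single ⟨u, hu⟩]
      · simp
      · intro j _ hj
        exact Finsupp.single_eq_of_ne fun h => hj (Subtype.ext h.symm)
      · simp
    · refine Finset.sum_eq_zero fun j _ => Finsupp.single_eq_of_ne fun h => hu (h ▸ j.2)
  have hρ : ρ ∈ S := by
    by_contra hρ
    have := hle ρ
    rw [h1, dif_neg hρ, Finsupp.single_eq_same] at this
    exact hk (by exact_mod_cast this)
  refine ⟨⟨ρ, hρ⟩, funext fun j => ?_⟩
  have h2 := hle j
  rw [h1, dif_pos j.2] at h2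
  by_cases hj : j = ⟨ρ, hρ⟩
  · subst hj
    rw [Finsupp.single_eq_same] at h2
    simp only [Pi.single_eq_same]
    exact_mod_cast h2.symm
  · rw [Finsupp.single_eq_of_ne fun h => hj (Subtype.ext h)] at h2
    rw [Pi.single_eq_of_ne hj]
    exact_mod_cast h2.symm

lemma LinearIndependent.eq_zero_of_sum_int_mul {V : Type*} {v : V → ℝ}
    (hv : LinearIndependent ℚ v) {S : Finset V} {p : S → ℤ}
    (h : ∑ j, (p j : ℝ) * v j = 0) : p = 0 := by
  have h1 := Fintype.linearIndependent_iff.1 (hv.comp (Subtype.val : S → V) Subtype.val_injective)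
    (fun j => (p j : ℚ)) (by
      simp only [Function.comp, Rat.smul_def]
      push_cast
      exact h)
  exact funext fun j => by exact_mod_cast h1 j

/-! ### Non-trivial zeros and the residues they produce. -/

lemma ne_one_of_mem_nontrivialZeros {ρ : ℂ} (hρ : ρ ∈ nontrivialZeros) : ρ ≠ 1 := by
  rintro rfl
  exact absurd hρ.2.2 (by simp)

lemma im_ne_zero_of_mem_nontrivialZeros {ρ : ℂ} (hρ : ρ ∈ nontrivialZeros) : ρ.im ≠ 0 := by
  intro h
  have h1 : ρ = (ρ.re : ℂ) := Complex.ext (by simp) (by simpa using h)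
  have h2 := (riemannZeta_eq_zero_iff (ne_one_of_mem_nontrivialZeros hρ)).1 hρ.1
  rw [h1] at h2
  exact riemannZeta₁_ofReal_ne_zero hρ.2.1 h2

open ComplexConjugate in
lemma conj_mem_nontrivialZeros {ρ : ℂ} (hρ : ρ ∈ nontrivialZeros) : conj ρ ∈ nontrivialZeros :=
  ⟨by rw [riemannZeta_conj, hρ.1, map_zero], by simpa using hρ.2.1, by simpa using hρ.2.2⟩

lemma RiemannHypothesis.re_eq_half (h : RiemannHypothesis) {ρ : ℂ} (hρ : ρ ∈ nontrivialZeros) :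
    ρ.re = 1 / 2 := by
  refine h ρ hρ.1 ?_ (ne_one_of_mem_nontrivialZeros hρ)
  rintro ⟨n, hn⟩
  have h1 := hρ.2.1
  rw [hn] at h1
  have h2 : (-2 * ((n : ℂ) + 1)).re = -2 * ((n : ℝ) + 1) := by simp
  rw [h2] at h1
  linarith [(n.cast_nonneg : (0 : ℝ) ≤ n)]

section mertensResidue

open Complex

variable {κ : ℝ}

lemma mem_nontrivialZeros_of_mertensDenom_eq_zero {t : ℝ} (ht : t ≠ 0)
    (h : mertensDenom κ (t * I) = 0) : (t : ℂ) * I + 1 / 2 ∈ nontrivialZeros := by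
  have h1 := ofReal_mul_I_add_ne_zero (t := t) (a := 3 / 2 - κ) (Or.inl ht)
  have h2 := ofReal_mul_I_add_ne_zero (t := t) (a := 1 / 2) (Or.inl ht)
  push_cast at h2
  have h3 : riemannZeta₁ (t * I + 1 / 2) = 0 := by
    simpa only [mertensDenom, mul_eq_zero, h1, h2, false_or] using h
  have h4 : (t : ℂ) * I + 1 / 2 ≠ 1 := fun h => ht (by simpa using congr_arg im h)
  exact ⟨(riemannZeta_eq_zero_iff h4).2 h3, by norm_num, by norm_num⟩

lemma im_mul_I_add_half {ρ : ℂ} (h : ρ.re = 1 / 2) : (ρ.im : ℂ) * I + 1 / 2 = ρ := by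
  apply Complex.ext <;> simp [h]

lemma mertensDenom_im_mul_I {ρ : ℂ} (hρ : ρ ∈ nontrivialZeros) (h : ρ.re = 1 / 2) :
    mertensDenom κ (ρ.im * I) = 0 := by
  rw [mertensDenom, im_mul_I_add_half h,
    (riemannZeta_eq_zero_iff (ne_one_of_mem_nontrivialZeros hρ)).1 hρ.1]
  simp

lemma deriv_mertensDenom_im_mul_I {ρ : ℂ} (hρ : ρ ∈ nontrivialZeros) (h : ρ.re = 1 / 2) :
    deriv (mertensDenom κ) (ρ.im * I) =
      (ρ - 1) * (ρ * (ρ - κ + 1) * deriv riemannZeta ρ) := by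
  have h1 := ne_one_of_mem_nontrivialZeros hρ
  have h2 : (ρ.im : ℂ) * I = ρ - 1 / 2 := by rw [← im_mul_I_add_half h]; simp
  rw [(hasDerivAt_mertensDenom κ _).deriv, im_mul_I_add_half h, (riemannZeta_eq_zero_iff h1).1 hρ.1,
    deriv_riemannZeta₁_of_eq_zero h1 hρ.1, h2]
  push_cast
  ring

lemma mertensResidue_im {ρ : ℂ} (hρ : ρ ∈ nontrivialZeros) (h : ρ.re = 1 / 2) :
    mertensResidue κ ρ.im = (ρ * (ρ - κ + 1) * deriv riemannZeta ρ)⁻¹ := by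
  have h1 := sub_ne_zero.2 (ne_one_of_mem_nontrivialZeros hρ)
  rw [mertensResidue, if_pos (mertensDenom_im_mul_I hρ h), deriv_mertensDenom_im_mul_I hρ h,
    show (ρ.im : ℂ) * I - 1 / 2 = ρ - 1 by
      linear_combination im_mul_I_add_half h, div_mul_eq_div_div, div_self h1, one_div]

lemma re_mertensResidue_zero : (mertensResidue κ 0).re = centralTerm κ := by
  rw [mertensResidue, centralTerm]
  by_cases h : mertensDenom κ ((0 : ℝ) * I) = 0
  · obtain ⟨h1, h2⟩ := deriv_mertensDenom_zero_ne_zero h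
    rw [if_pos h, if_pos h1, h2, riemannZeta₁_eq (by norm_num)]
    congr 1
    have h3 : riemannZeta (1 / 2) ≠ 0 :=
      (riemannZeta_eq_zero_iff (by norm_num)).not.2 riemannZeta₁_half_ne_zero
    simp only [ofReal_zero, zero_mul, zero_sub]
    field_simp
    norm_num
  · rw [if_neg h, if_neg, zero_re]
    rintro rfl
    simp [mertensDenom] at h

end mertensResidue

/-! ### The bound for finite sums over zeros. -/

section upperBound

open MeasureTheory ProbabilityTheory Filter Topology Complex

variable {κ ε C B : ℝ}

lemma riemannHypothesis_of_upperBound (hκ : κ ≤ 3 / 2) (hε : |ε| = 1)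
    (h0 : ∀ x, 1 < x → 0 ≤ C + B / x - ε * normalizedIntegral κ x) : RiemannHypothesis := by
  refine riemannHypothesis_of_ne_zero fun s hs h => ?_
  refine (mertensDenom_ne_zero_and_complexMGF_boundMeasure hκ hε h0).2.1 (s - 1 / 2) ?_ ?_
  · simp at hs ⊢; linarith
  · rw [mertensDenom, sub_add_cancel, h]
    simp

lemma sum_le_of_upperBound (hLI : LinearIndependenceConjecture) (hκ : κ ≤ 3 / 2) (hε : |ε| = 1)
    (h0 : ∀ x, 1 < x → 0 ≤ C + B / x - ε * normalizedIntegral κ x)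
    (S : Finset {ρ : ℂ // ρ ∈ nontrivialZeros ∧ 0 < ρ.im}) :
    ∑ ρ ∈ S, ‖(ρ : ℂ) * ((ρ : ℂ) - κ + 1) * deriv riemannZeta ρ‖⁻¹ ≤ C - ε * centralTerm κ := by
  classical
  have hRH := riemannHypothesis_of_upperBound hκ hε h0
  have hv := hLI hRH
  set v := fun ρ : {ρ : ℂ // ρ ∈ nontrivialZeros ∧ 0 < ρ.im} => (ρ : ℂ).im with hvdef
  obtain ⟨hint, -, -⟩ := mertensDenom_ne_zero_and_complexMGF_boundMeasure hκ hε h0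
  have hkey := sum_norm_le_of_rieszProduct (aemeasurable_neg_log_mellinMeasure) hint
    (tendsto_mul_complexMGF_boundMeasure hκ hε h0) (fun j : S => v j) ?_
  · rw [if_pos rfl, sub_re, re_ofReal_mul, ofReal_re, re_mertensResidue_zero] at hkey
    refine le_trans (le_of_eq ?_) hkey
    rw [← Finset.sum_coe_sort]
    refine Finset.sum_congr rfl fun j _ => ?_
    have hj := j.1.2
    rw [if_neg hj.2.ne', zero_sub, norm_neg, norm_mul (ε : ℂ), norm_real, Real.norm_eq_abs, hε, one_mul,
      mertensResidue_im hj.1 (hRH.re_eq_half hj.1), norm_inv]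
  · intro p _ hp0 hp1
    set t := ∑ j, (p j : ℝ) * v j with ht
    have ht0 : t ≠ 0 := fun h => hp0 (hv.eq_zero_of_sum_int_mul h)
    rw [if_neg ht0, mertensResidue, if_neg, mul_zero, sub_zero]
    intro hD
    -- A pole at this frequency makes `±t` the ordinate of a zero in the upper half-plane, so
    -- independence reduces `p` to a single entry `±1`, the excluded case.
    have hz := mem_nontrivialZeros_of_mertensDenom_eq_zero ht0 hD
    rcases lt_or_gt_of_ne ht0 with hneg | hpos
    · have hz' := conj_mem_nontrivialZeros hz
      obtain ⟨j, hj⟩ := hv.eq_single_of_sum_int_mul (S := S) (p := p) (k := -1) (by norm_num)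
        (ρ := ⟨_, hz', by simpa using hneg⟩) (ht.symm.trans (by simp [hvdef]))
      exact (hp1 j).2 hj
    · obtain ⟨j, hj⟩ := hv.eq_single_of_sum_int_mul (S := S) (p := p) (k := 1) (by norm_num)
        (ρ := ⟨_, hz, by simpa using hpos⟩) (ht.symm.trans (by simp [hvdef]))
      exact (hp1 j).1 hj

/-- Needed to pass from real inverses to those in `ℝ≥0∞`, since `0⁻¹` is `0` in the former and `∞`
in the latter. -/
lemma mul_deriv_riemannZeta_ne_zero_of_upperBound (hκ : κ ≤ 3 / 2) (hε : |ε| = 1)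
    (h0 : ∀ x, 1 < x → 0 ≤ C + B / x - ε * normalizedIntegral κ x) {ρ : ℂ}
    (hρ : ρ ∈ nontrivialZeros) : ρ * (ρ - κ + 1) * deriv riemannZeta ρ ≠ 0 := by
  have hre := (riemannHypothesis_of_upperBound hκ hε h0).re_eq_half hρ
  have := deriv_mertensDenom_ne_zero hκ hε h0 (mertensDenom_im_mul_I hρ hre)
  rw [deriv_mertensDenom_im_mul_I hρ hre] at this
  exact right_ne_zero_of_mul this

end upperBound

/-! ### Conjugate symmetry and the conclusion. -/

open ComplexConjugate in
lemma deriv_riemannZeta_conj (s : ℂ) :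
    deriv riemannZeta (conj s) = conj (deriv riemannZeta s) := by
  have h : riemannZeta = conj ∘ riemannZeta ∘ conj := by
    ext s; simp [riemannZeta_conj]
  conv_lhs => rw [h]
  rw [deriv_conj_conj]
  simp

open ComplexConjugate in
lemma zeroSum_le_two_mul (κ : ℝ) :
    zeroSum κ ≤ 2 * ∑' ρ : {ρ : ℂ // ρ ∈ nontrivialZeros ∧ 0 < ρ.im},
      ‖(ρ : ℂ) * ((ρ : ℂ) - κ + 1) * deriv riemannZeta ρ‖ₑ⁻¹ := by
  set a : ℂ → ℝ≥0∞ := fun ρ => ‖ρ * (ρ - κ + 1) * deriv riemannZeta ρ‖ₑ⁻¹ with ha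
  have haconj : ∀ ρ, a (conj ρ) = a ρ := by
    intro ρ
    have : conj ρ * (conj ρ - κ + 1) * deriv riemannZeta (conj ρ) =
        conj (ρ * (ρ - κ + 1) * deriv riemannZeta ρ) := by
      rw [deriv_riemannZeta_conj]; simp
    simp only [ha]
    rw [this, RCLike.enorm_conj]
  set P : Set ℂ := {ρ | ρ ∈ nontrivialZeros ∧ 0 < ρ.im}
  set N : Set ℂ := {ρ | ρ ∈ nontrivialZeros ∧ ρ.im < 0}
  have hsub : nontrivialZeros = P ∪ N := by
    ext ρ
    constructor
    · intro hρ
      exact (lt_or_gt_of_ne (im_ne_zero_of_mem_nontrivialZeros hρ)).elim (fun h => Or.inr ⟨hρ, h⟩)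
        fun h => Or.inl ⟨hρ, h⟩
    · rintro (h | h) <;> exact h.1
  have hN : ∑' ρ : N, a ρ ≤ ∑' ρ : P, a ρ := by
    let f : N → P := fun ρ => ⟨conj (ρ : ℂ), conj_mem_nontrivialZeros ρ.2.1, by
      simpa using ρ.2.2⟩
    have hf : Function.Injective f := fun x y h => Subtype.ext
      ((starRingEnd ℂ).injective (congr_arg Subtype.val h))
    calc ∑' ρ : N, a ρ = ∑' ρ : N, a (f ρ) := tsum_congr fun ρ => (haconj ρ).symm
      _ ≤ _ := ENNReal.tsum_comp_le_tsum_of_injective hf fun ρ : P => a ρ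
  calc zeroSum κ = ∑' ρ : nontrivialZeros, a ρ := rfl
    _ = ∑' ρ : (P ∪ N : Set ℂ), a ρ := by rw [hsub]
    _ ≤ ∑' ρ : P, a ρ + ∑' ρ : N, a ρ := ENNReal.tsum_union_le a P N
    _ ≤ 2 * ∑' ρ : P, a ρ := by rw [two_mul]; gcongr

lemma zeroSum_div_two_le_of_eventually_le (hLI : LinearIndependenceConjecture) {κ : ℝ}
    (hκ : κ ≤ 3 / 2) {ε C : ℝ} (hε : |ε| = 1)
    (h : ∀ᶠ x in Filter.atTop, ε * normalizedIntegral κ x ≤ C) :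
    zeroSum κ / 2 ≤ ENNReal.ofReal (C - ε * centralTerm κ) ∧ 0 ≤ C - ε * centralTerm κ := by
  obtain ⟨B, h0⟩ := exists_nonneg_of_eventually_le hκ hε h
  have hS := sum_le_of_upperBound hLI hκ hε h0
  -- The empty set of zeros gives the nonnegativity, without which `ENNReal.ofReal` would truncate.
  refine ⟨ENNReal.div_le_of_le_mul' ((zeroSum_le_two_mul κ).trans ?_), by simpa using hS ∅⟩
  gcongr
  rw [ENNReal.tsum_eq_iSup_sum]
  refine iSup_le fun S => ?_
  refine le_trans (le_of_eq ?_) (ENNReal.ofReal_le_ofReal (hS S))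
  rw [ENNReal.ofReal_sum_of_nonneg fun _ _ => by positivity]
  refine Finset.sum_congr rfl fun ρ _ => ?_
  rw [ENNReal.ofReal_inv_of_pos (norm_pos_iff.2
    (mul_deriv_riemannZeta_ne_zero_of_upperBound hκ hε h0 ρ.2.1)), ofReal_norm]

theorem mainTheorem5 (hLI : LinearIndependenceConjecture) (κ : ℝ) (hκ : κ ≤ 3 / 2) :
    ((centralTerm κ : ℝ) : EReal) + ((zeroSum κ / 2 : ℝ≥0∞) : EReal) ≤
        Filter.limsup (fun x : ℝ => ((normalizedIntegral κ x : ℝ) : EReal)) Filter.atTop ∧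
      Filter.liminf (fun x : ℝ => ((normalizedIntegral κ x : ℝ) : EReal)) Filter.atTop ≤
        ((centralTerm κ : ℝ) : EReal) - ((zeroSum κ / 2 : ℝ≥0∞) : EReal) := by
  have hcoe : ∀ y : ℝ, 0 ≤ y → ((ENNReal.ofReal y : ℝ≥0∞) : EReal) = y := fun y hy => by
    rw [EReal.coe_ennreal_ofReal, max_eq_left hy]
  constructor
  -- It suffices to treat real `C` above the limsup; there are none if the limsup is `+∞`.
  · rw [← EReal.le_of_forall_lt_iff_le]
    intro C hC
    have h1 : ∀ᶠ x in Filter.atTop, (1 : ℝ) * normalizedIntegral κ x ≤ C := by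
      filter_upwards [Filter.eventually_lt_of_limsup_lt hC] with x hx
      rw [one_mul]
      exact (EReal.coe_lt_coe_iff.1 hx).le
    obtain ⟨h2, h3⟩ := zeroSum_div_two_le_of_eventually_le hLI hκ abs_one h1
    calc ((centralTerm κ : ℝ) : EReal) + ((zeroSum κ / 2 : ℝ≥0∞) : EReal)
        ≤ (centralTerm κ : ℝ) + ((ENNReal.ofReal (C - 1 * centralTerm κ) : ℝ≥0∞) : EReal) := by
          gcongr
          exact_mod_cast h2
      _ = C := by
          rw [hcoe _ h3, ← EReal.coe_add]
          congr 1; ring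
  · rw [← EReal.ge_of_forall_gt_iff_ge]
    intro C hC
    have h1 : ∀ᶠ x in Filter.atTop, (-1 : ℝ) * normalizedIntegral κ x ≤ -C := by
      filter_upwards [Filter.eventually_lt_of_lt_liminf hC] with x hx
      linarith [EReal.coe_lt_coe_iff.1 hx]
    obtain ⟨h2, h3⟩ := zeroSum_div_two_le_of_eventually_le hLI hκ (by simp) h1
    calc (C : EReal) = (centralTerm κ : ℝ) -
          ((ENNReal.ofReal (-C - -1 * centralTerm κ) : ℝ≥0∞) : EReal) := by
          rw [hcoe _ h3, ← EReal.coe_sub]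
          congr 1; ring
      _ ≤ _ := by
          refine EReal.sub_le_sub le_rfl ?_
          exact_mod_cast h2
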